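/- Definitions. A set $\Gamma\subseteq\mathbb{R}^d$ is relatively separated if $\sup_{x}\#(\Gamma\cap B_1(x))<\infty$, and separated if $\inf\{|\lambda-\lambda'|:\lambda\neq\lambda'\in\Gamma\}>0$ (with $\inf\emptyset=\infty$). $W(L^\infty,L^1)(\mathbb{R}^d)$ is the space of all $\Theta\in L^\infty(\mathbb{R}^d)$ with $\int_{\mathbb{R}^d}\|\Theta\|_{L^\infty(B_1(x))}\,dx<\infty$. A closed subspace $V\subseteq L^2(\mathbb{R}^d)$ (complex-valued functions) is a localizable reproducing kernel Hilbert space if it has a localized frame, that is, a frame $\{F_\gamma:\gamma\in\Gamma\}\subseteq V$, indexed by a relatively separated set $\Gamma\subseteq\mathbb{R}^d$, of continuous functions with $|F_\gamma(x)|\le\Theta(x-\gamma)$ for some $\Theta\in W(L^\infty,L^1)(\mathbb{R}^d)$. For $p\in[1,\infty]$ let $$V^p=\Big\{\sum_{\gamma\in\Gamma}c_\gamma F_\gamma: c\in\ell^p(\Gamma)\Big\}\subseteq L^p(\mathbb{R}^d),$$ with unconditional convergence in $L^p$ for $p<\infty$ and in the weak$^*$ topology for $p=\infty$; its elements are identified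 with their continuous representatives. $V$ (with this frame) is uniformly localizable if $$\sup_{|x-y|\le\delta}\ \sup_{f\in V^\infty,\ \|f\|_\infty\le1}\big||f(x)|-|f(y)|\big|\longrightarrow0\quad\text{as }\delta\to0^+.$$ For an $n$-dimensional space $P$ of functions on $\mathbb{R}^d$ with basis $p_1,\dots,p_n$, a set $\{x_1,\dots,x_n\}$ is a set of Fekete points for $P$ if $(x_1,\dots,x_n)$ maximizes $|\det(p_i(y_j))_{i,j}|$ over all $y_1,\dots,y_n\in\mathbb{R}^d$. Sets $X_j\subseteq\mathbb{R}^d$ converge weakly to $\Lambda$ if for all $R,\varepsilon>0$ and all sufficiently large $j$, $\Lambda\cap B_R(0)\subseteq X_j+B_\varepsilon(0)$ and $X_j\cap B_R(0)\subseteq\Lambda+B_\varepsilon(0)$. Theorem. Let $V\subseteq L^2(\mathbb{R}^d)$ be a uniformly localizable reproducing kernel Hilbert space, with localized frame $\{F_\gamma\}$. Then there exists a separated set $\Lambda\subseteq\mathbb{R}^d$ with the following properties. (i) ($\ell^1$–$\ell^\infty$ interpolation.) There are functions $\{l_\lambda:\lambda\in\Lambda\}\subseteq V^\infty$ with $\|l_\lambda\|_\infty=1$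 and $l_\lambda(\lambda')=\delta_{\lambda,\lambda'}$ for all $\lambda,\lambda'\in\Lambda$. In particular, for every $a\in\ell^1(\Lambda)$ the series $f=\sum_{\lambda\in\Lambda}a_\lambda l_\lambda$ converges uniformly, $f\in V^\infty$, and $f(\lambda)=a_\lambda$ for all $\lambda\in\Lambda$. (ii) ($\ell^1$–$\ell^\infty$ sampling.) For all $f\in V^1$ one has $\sum_{\lambda\in\Lambda}|f(\lambda)|<\infty$ and $\|f\|_\infty\le\sum_{\lambda\in\Lambda}|f(\lambda)|$. (iii) $\Lambda$ is a weak limit of Fekete points for $V^1$: there are nested finite-dimensional subspaces $P_1\subseteq P_2\subseteq\cdots$ of $V^1$, whose union is dense in $V^1$ for the $L^1$ norm, and sets $X_n$ of Fekete points for $P_n$ that converge weakly to $\Lambda$. -/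

import Mathlib

open MeasureTheory Filter Topology
open scoped ENNReal

/-- Euclidean space `ℝ^d` with the Euclidean norm and Lebesgue measure `volume`. -/
abbrev Rd (d : ℕ) : Type := EuclideanSpace ℝ (Fin d)

/-- The Hilbert space `L²(ℝ^d)` of complex-valued functions. -/
abbrev L2Rd (d : ℕ) : Type := Lp ℂ 2 (volume : Measure (Rd d))

/-- `Γ` is relatively separated: the number of points of `Γ` in a ball of radius `1` is bounded. -/
def IsRelSeparated {d : ℕ} (Γ : Set (Rd d)) : Prop :=
  ∃ N : ℕ, ∀ x : Rd d, (Γ ∩ Metric.ball x 1).encard ≤ N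

/-- `Λ` is separated: distinct points have distance at least some fixed `δ > 0`. -/
def IsSeparatedSet {d : ℕ} (Λ : Set (Rd d)) : Prop :=
  ∃ δ : ℝ, 0 < δ ∧ Λ.Pairwise fun x y => δ ≤ dist x y

/-- The amalgam space `W(L^∞, L¹)(ℝ^d)`: essentially bounded functions `Θ` with
`∫ ‖Θ‖_{L^∞(B_1(x))} dx < ∞`. -/
def MemAmalgam {d : ℕ} (Θ : Rd d → ℝ) : Prop :=
  MemLp Θ ∞ volume ∧
    ∫⁻ x : Rd d, eLpNorm Θ ∞ (volume.restrict (Metric.ball x 1)) < ∞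

/-- A localized frame for a subspace `V` of `L²(ℝ^d)`: a frame `{F_γ : γ ∈ Γ}` of `V`, indexed by a
relatively separated set `Γ` of nodes, which consists of continuous functions and satisfies
`|F_γ(x)| ≤ Θ(x - γ)` with an envelope `Θ ∈ W(L^∞, L¹)(ℝ^d)` (an `L^∞` function, so that the
inequality is one between functions defined almost everywhere). A closed subspace `V` of
`L²(ℝ^d)` that has a localized frame is a localizable reproducing kernel Hilbert space. -/
structure LocalizedFrame {d : ℕ} (V : Submodule ℂ (L2Rd d)) where
  /-- the nodes -/
  Γ : Set (Rd d)
  relSeparated : IsRelSeparated Γ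
  /-- the envelope -/
  Θ : Rd d → ℝ
  memAmalgam : MemAmalgam Θ
  /-- the frame elements, as continuous functions -/
  F : Γ → Rd d → ℂ
  continuous_F : ∀ γ, Continuous (F γ)
  localized : ∀ γ : Γ, ∀ᵐ x ∂(volume : Measure (Rd d)), ‖F γ x‖ ≤ Θ (x - (γ : Rd d))
  memLp_F : ∀ γ, MemLp (F γ) 2 (volume : Measure (Rd d))
  mem_V : ∀ γ, (memLp_F γ).toLp (F γ) ∈ V
  frame : ∃ A B : ℝ, 0 < A ∧ ∀ f ∈ V,
    Summable (fun γ : Γ => ‖inner ℂ ((memLp_F γ).toLp (F γ)) f‖ ^ 2) ∧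
    A * ‖f‖ ^ 2 ≤ ∑' γ : Γ, ‖inner ℂ ((memLp_F γ).toLp (F γ)) f‖ ^ 2 ∧
    ∑' γ : Γ, ‖inner ℂ ((memLp_F γ).toLp (F γ)) f‖ ^ 2 ≤ B * ‖f‖ ^ 2

namespace LocalizedFrame

variable {d : ℕ} {V : Submodule ℂ (L2Rd d)}

/-- `f = ∑_γ c_γ F_γ`, with unconditional convergence in `L^p` if `p < ∞`, and in the weak-star
topology of `L^∞ = (L¹)'` if `p = ∞`. -/
def IsSeriesSum (𝓕 : LocalizedFrame V) (p : ℝ≥0∞) (c : 𝓕.Γ → ℂ) (f : Rd d → ℂ) : Prop :=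
  (p ≠ ∞ → Tendsto (fun s : Finset 𝓕.Γ =>
      eLpNorm (fun x => f x - ∑ γ ∈ s, c γ * 𝓕.F γ x) p volume) atTop (𝓝 0)) ∧
  (p = ∞ → ∀ g : Rd d → ℂ, Integrable g volume →
      HasSum (fun γ : 𝓕.Γ => ∫ x, (c γ * 𝓕.F γ x) * g x) (∫ x, f x * g x))

/-- The space `V^p = {∑_γ c_γ F_γ : c ∈ ℓ^p(Γ)} ⊆ L^p(ℝ^d)`, for `1 ≤ p ≤ ∞`. Its elements are
given by their (unique) continuous representatives. The space does not depend on the choice of the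
localized frame of `V`. -/
def space (𝓕 : LocalizedFrame V) (p : ℝ≥0∞) : Set (Rd d → ℂ) :=
  {f | Continuous f ∧ MemLp f p volume ∧ ∃ c : 𝓕.Γ → ℂ, Memℓp c p ∧ 𝓕.IsSeriesSum p c f}

/-- Uniform localizability: the moduli of the functions in the unit ball of `V^∞` are uniformly
equicontinuous, that is, the supremum of `||f(x)| - |f(y)||` over `|x - y| ≤ δ` and over
`f ∈ V^∞` with `‖f‖_∞ ≤ 1` tends to `0` as `δ → 0⁺`. -/
def IsUniform (𝓕 : LocalizedFrame V) : Prop :=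
  ∀ ε : ℝ, 0 < ε → ∃ δ : ℝ, 0 < δ ∧ ∀ x y : Rd d, dist x y ≤ δ →
    ∀ f ∈ 𝓕.space ∞, eLpNorm f ∞ volume ≤ 1 → |‖f x‖ - ‖f y‖| ≤ ε

end LocalizedFrame

/-- Weak convergence of subsets of `ℝ^d`: for all `R, ε > 0` and all large `j`,
`Λ ∩ B_R(0) ⊆ Λ_j + B_ε(0)` and `Λ_j ∩ B_R(0) ⊆ Λ + B_ε(0)`. -/
def SetWeakConverges {d : ℕ} (X : ℕ → Set (Rd d)) (Λ : Set (Rd d)) : Prop :=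
  ∀ R ε : ℝ, 0 < R → 0 < ε → ∃ j₀ : ℕ, ∀ j ≥ j₀,
    Λ ∩ Metric.ball 0 R ⊆ Metric.thickening ε (X j) ∧
    X j ∩ Metric.ball 0 R ⊆ Metric.thickening ε Λ

/-- `X` is a set of Fekete points for the finite-dimensional space `P` of functions on `ℝ^d`: with
`p_1, …, p_n` a basis of `P`, `X = {x_1, …, x_n}`, where `(x_1, …, x_n)` maximizes
`|det (p_i(y_j))|` over all `y_1, …, y_n ∈ ℝ^d`. (A different basis only multiplies the function
to be maximized by a non-zero constant.) -/
def IsFeketeSet {d : ℕ} (P : Submodule ℂ (Rd d → ℂ)) (X : Set (Rd d)) : Prop :=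
  ∃ (n : ℕ) (p : Module.Basis (Fin n) ℂ P) (x : Fin n → Rd d), X = Set.range x ∧
    ∀ y : Fin n → Rd d,
      ‖(Matrix.of fun i j => (p i : Rd d → ℂ) (y j)).det‖ ≤
        ‖(Matrix.of fun i j => (p i : Rd d → ℂ) (x j)).det‖

/-- `Λ` is a weak limit of Fekete points for a family `W` of integrable functions: there are nested
finite-dimensional spaces `P_n ⊆ W` with union dense in `W` for the `L¹` norm, and sets `X_n` of
Fekete points for `P_n` that converge weakly to `Λ`. -/
def IsWeakLimitOfFekete {d : ℕ} (W : Set (Rd d → ℂ)) (Λ : Set (Rd d)) : Prop :=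
  ∃ (P : ℕ → Submodule ℂ (Rd d → ℂ)) (X : ℕ → Set (Rd d)),
    Monotone P ∧ (∀ n, (P n : Set (Rd d → ℂ)) ⊆ W) ∧
    (∀ f ∈ W, ∀ ε : ℝ≥0∞, 0 < ε → ∃ n, ∃ g ∈ P n, eLpNorm (fun x => f x - g x) 1 volume < ε) ∧
    (∀ n, IsFeketeSet (P n) (X n)) ∧ SetWeakConverges X Λ

/-! Let `P_n` be the span of the frame elements with nodes of norm at most `n`. Its functions are
continuous and vanish at infinity, so Fekete points exist. By Cramer's rule each Lagrange function
is a quotient of two determinants, and maximality of the denominator bounds it by one. Expanding `f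
∈ P_n` in Lagrange functions gives `‖f‖_∞ ≤ ∑ |f(x_j)|`. A Lagrange function drops from 1 to 0
between two Fekete points, so uniform localizability separates these points by a distance
independent of `n`. Uniformly separated sets have weakly convergent subsequences, and the limit of
one of them is `Λ`.

Sampling passes to the limit because functions in `P_n` have a summable envelope over unit cubes:
the part of the sum far from the origin is uniformly small, and near the origin each Fekete point is
paired with its own point of `Λ`. The inequality extends from the spans to `V^1` by dominated
convergence.

Interpolation needs limits of Lagrange functions to stay in `V^∞`, hence coefficients bounded in
`ℓ^∞` by the sup norm of the function (`exists_uniform_coeff_bound`). With such a bound,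
coefficientwise limits give pointwise limits of the series; equicontinuity of the moduli preserves
modulus one and the zeros, and a unimodular factor restores the value 1.

The coefficient bound is the analytic core (`BlockDecomposition.exists_localNorm_solution`): the
frame operator `S`, bounded below on `V` in `L²`, must also be bounded below there in a sup-type
norm, the supremum of `L²` norms over cubes of a fixed large size. For operators with summable
off-diagonal decay this norm is controlled by the `L²` operator norm times a dimensional constant,
plus a tail that vanishes for large cubes. A power `w` of `u = 1 - S/B` is small on `V`, but it is
the identity on `Vᗮ`, and truncation to cubes leaves `V`. However, `w(1-w)` vanishes on `Vᗮ` and is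
small on the whole space. The iterates `z_i = (1-w)^{-i} f` in `V` satisfy `z_{i+1} = z_i + w(1-w)
z_{i+2}`; the resulting three-term inequality, together with the a priori `L²` growth of `z_i`,
bounds `z_1` by `z_0 = f` in the local norm. -/

/-! ### Unit cubes of `ℝ^d` -/

/-- The index of the unit cube of the lattice `ℤ^d` that contains `x`. -/
noncomputable def cubeIndex {d : ℕ} (x : Rd d) : Fin d → ℤ := fun i => ⌊x i⌋

/-- A lattice point, as a point of `ℝ^d`. -/
noncomputable def latticePoint {d : ℕ} (k : Fin d → ℤ) : Rd d :=
  WithLp.toLp 2 fun i => (k i : ℝ)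

@[simp] theorem latticePoint_apply {d : ℕ} (k : Fin d → ℤ) (i : Fin d) :
    latticePoint k i = (k i : ℝ) := rfl

theorem measurable_cubeIndex {d : ℕ} : Measurable (cubeIndex (d := d)) := by
  refine measurable_pi_iff.2 fun i => ?_
  have : Measurable fun x : Rd d => x i := by fun_prop
  exact Int.measurable_floor.comp this

theorem norm_le_of_abs_apply_le_one {d : ℕ} {v : Rd d} (h : ∀ i, |v i| ≤ 1) :
    ‖v‖ ≤ d + 1 := by
  rw [EuclideanSpace.norm_eq]
  refine Real.sqrt_le_iff.2 ⟨by positivity, ?_⟩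
  calc ∑ i, ‖v i‖ ^ 2 ≤ ∑ _i : Fin d, (1 : ℝ) :=
        Finset.sum_le_sum fun i _ => pow_le_one₀ (norm_nonneg _) (h i)
    _ = d := by simp
    _ ≤ ((d : ℝ) + 1) ^ 2 := by nlinarith [(Nat.cast_nonneg d : (0 : ℝ) ≤ d)]

theorem norm_sub_latticePoint_le {d : ℕ} (x : Rd d) :
    ‖x - latticePoint (cubeIndex x)‖ ≤ d + 1 := by
  refine norm_le_of_abs_apply_le_one fun i => ?_
  have h1 := Int.floor_le (x i)
  have h2 := Int.lt_floor_add_one (x i)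
  simp only [PiLp.sub_apply, latticePoint_apply, cubeIndex]
  rw [abs_le]
  constructor <;> linarith

theorem norm_sub_sub_latticePoint_le {d : ℕ} (x y : Rd d) :
    ‖(x - y) - latticePoint (cubeIndex x - cubeIndex y)‖ ≤ d + 1 := by
  refine norm_le_of_abs_apply_le_one fun i => ?_
  have h1 := Int.floor_le (x i)
  have h2 := Int.lt_floor_add_one (x i)
  have h3 := Int.floor_le (y i)
  have h4 := Int.lt_floor_add_one (y i)
  simp only [PiLp.sub_apply, latticePoint_apply, cubeIndex, Pi.sub_apply, Int.cast_sub]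
  rw [abs_le]
  constructor <;> linarith

theorem one_le_dist_latticePoint {d : ℕ} {k l : Fin d → ℤ} (h : k ≠ l) :
    1 ≤ dist (latticePoint k) (latticePoint l) := by
  obtain ⟨i, hi⟩ := Function.ne_iff.1 h
  have h1 : ‖(latticePoint k - latticePoint l) i‖ ≤ ‖latticePoint k - latticePoint l‖ :=
    PiLp.norm_apply_le _ i
  rw [dist_eq_norm]
  refine le_trans ?_ h1
  simp only [PiLp.sub_apply, latticePoint_apply, Real.norm_eq_abs]
  have : (1 : ℤ) ≤ |k i - l i| := Int.one_le_abs (sub_ne_zero.2 hi)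
  exact_mod_cast this

theorem exists_finset_cover_closedBall (d : ℕ) {r : ℝ} (hr : 0 < r) (R : ℝ) :
    ∃ T : Finset (Rd d), ∀ v : Rd d, ‖v‖ ≤ R → ∃ t ∈ T, dist v t < r := by
  obtain ⟨T, -, hT, hcov⟩ :=
    (isCompact_closedBall (0 : Rd d) R).finite_cover_balls hr
  refine ⟨hT.toFinset, fun v hv => ?_⟩
  have := hcov (mem_closedBall_zero_iff.2 hv)
  simpa using this

theorem finite_cubeIndex_norm_le (d : ℕ) (R : ℝ) :
    {k : Fin d → ℤ | ∃ x : Rd d, cubeIndex x = k ∧ ‖x‖ ≤ R}.Finite := by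
  refine (Set.finite_Icc (fun _ : Fin d => -⌈R⌉ - 1) (fun _ : Fin d => ⌈R⌉)).subset ?_
  rintro k ⟨x, rfl, hx⟩
  have h : ∀ i, |x i| ≤ R := fun i => (PiLp.norm_apply_le x i).trans hx
  refine ⟨fun i => ?_, fun i => ?_⟩
  · have := (abs_le.1 (h i)).1
    have h2 := Int.lt_floor_add_one (x i)
    have h3 := Int.le_ceil R
    have : (-⌈R⌉ - 1 : ℤ) < (⌊x i⌋ : ℝ) := by push_cast; linarith
    exact (by exact_mod_cast this : -⌈R⌉ - 1 < ⌊x i⌋).le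
  · have := (abs_le.1 (h i)).2
    have h2 := Int.floor_le (x i)
    have h3 := Int.le_ceil R
    have : (⌊x i⌋ : ℝ) ≤ (⌈R⌉ : ℤ) := by linarith
    exact_mod_cast this

theorem tendsto_cubeIndex_cocompact (d : ℕ) :
    Tendsto (cubeIndex (d := d)) (cocompact (Rd d)) cofinite := by
  intro s hs
  rw [mem_cofinite] at hs
  rw [mem_map, Metric.mem_cocompact_iff_closedBall_compl_subset 0]
  obtain ⟨M, hM⟩ : ∃ M : ℝ, ∀ k ∈ sᶜ, ‖latticePoint k‖ ≤ M := by
    obtain ⟨M, hM⟩ := (hs.image fun k => ‖latticePoint k‖).bddAbove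
    exact ⟨M, fun k hk => hM ⟨k, hk, rfl⟩⟩
  refine ⟨M + (d + 1), fun x hx => ?_⟩
  by_contra hxs
  refine hx (mem_closedBall_zero_iff.2 ?_)
  have h1 := hM _ hxs
  have h2 := norm_sub_latticePoint_le x
  calc ‖x‖ = ‖latticePoint (cubeIndex x) + (x - latticePoint (cubeIndex x))‖ := by
        congr 1; abel
    _ ≤ _ := norm_add_le _ _
    _ ≤ _ := add_le_add h1 h2

/-! ### Counting points in cubes -/

/-- A set has at most `N` points in every unit cube. -/
def CubeCardLE {d : ℕ} (X : Set (Rd d)) (N : ℕ) : Prop :=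
  ∀ s : Finset X, ∀ k : Fin d → ℤ, (s.filter fun x : X => cubeIndex (x : Rd d) = k).card ≤ N

/-- Finitely many balls of radius `r`, translated with the cube, cover every unit cube. The constant
`M` does not depend on the set `X`, so one bound serves a whole sequence of sets. -/
theorem CubeCardLE.of_ball {d : ℕ} {r : ℝ} (hr : 0 < r) (N : ℕ) :
    ∃ M : ℕ, ∀ X : Set (Rd d), (∀ x : Rd d, (X ∩ Metric.ball x r).encard ≤ N) →
      CubeCardLE X M := by
  classical
  obtain ⟨T, hT⟩ := exists_finset_cover_closedBall d hr (d + 1)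
  refine ⟨T.card * N, fun X hX s k => ?_⟩
  have hsub : (s.filter fun x : X => cubeIndex (x : Rd d) = k) ⊆
      T.biUnion fun t => s.filter fun x : X => (x : Rd d) ∈ Metric.ball (latticePoint k + t) r := by
    intro x hx
    obtain ⟨hxs, hxk⟩ := Finset.mem_filter.1 hx
    obtain ⟨t, ht, hd⟩ := hT _ (norm_sub_latticePoint_le (x : Rd d))
    refine Finset.mem_biUnion.2 ⟨t, ht, Finset.mem_filter.2 ⟨hxs, ?_⟩⟩
    rw [Metric.mem_ball, dist_eq_norm]
    rw [dist_eq_norm, hxk] at hd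
    rwa [← sub_sub]
  refine (Finset.card_le_card hsub).trans (Finset.card_biUnion_le_card_mul _ _ _ fun t _ => ?_)
  have h1 := hX (latticePoint k + t)
  have h2 : ((s.filter fun x : X => (x : Rd d) ∈ Metric.ball (latticePoint k + t) r).map
      (Function.Embedding.subtype _) : Set (Rd d)) ⊆ X ∩ Metric.ball (latticePoint k + t) r := by
    intro y hy
    simp only [Finset.coe_map, Function.Embedding.subtype_apply, Set.mem_image, Finset.mem_coe,
      Finset.mem_filter] at hy
    obtain ⟨x, ⟨-, hx⟩, rfl⟩ := hy
    exact ⟨x.2, hx⟩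
  have h3 := (Set.encard_le_encard h2).trans h1
  rw [Set.encard_coe_eq_coe_finsetCard, Finset.card_map] at h3
  exact_mod_cast h3

theorem CubeCardLE.of_separated (d : ℕ) {δ : ℝ} (hδ : 0 < δ) :
    ∃ M : ℕ, ∀ X : Set (Rd d), X.Pairwise (fun x y => δ ≤ dist x y) → CubeCardLE X M := by
  obtain ⟨M, hM⟩ := CubeCardLE.of_ball (d := d) (half_pos hδ) 1
  refine ⟨M, fun X hX => hM X fun x => ?_⟩
  rw [Nat.cast_one, Set.encard_le_one_iff]
  rintro a b ⟨ha, hax⟩ ⟨hb, hbx⟩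
  by_contra hab
  have h1 := hX ha hb hab
  have h2 := dist_triangle_right a b x
  rw [Metric.mem_ball] at hax hbx
  linarith

theorem CubeCardLE.sum_le {d : ℕ} {X : Set (Rd d)} {N : ℕ} (hX : CubeCardLE X N)
    {φ : (Fin d → ℤ) → ℝ} (h0 : ∀ k, 0 ≤ φ k) (s : Finset X) {t : Finset (Fin d → ℤ)}
    (hst : ∀ x ∈ s, cubeIndex (x : Rd d) ∈ t) :
    ∑ x ∈ s, φ (cubeIndex (x : Rd d)) ≤ N * ∑ k ∈ t, φ k := by
  classical
  rw [← Finset.sum_fiberwise_of_maps_to hst, Finset.mul_sum]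
  refine Finset.sum_le_sum fun k _ => ?_
  rw [Finset.sum_congr rfl fun x hx => by rw [(Finset.mem_filter.1 hx).2], Finset.sum_const,
    nsmul_eq_mul]
  exact mul_le_mul_of_nonneg_right (by exact_mod_cast hX s k) (h0 k)

theorem CubeCardLE.sum_le_tsum {d : ℕ} {X : Set (Rd d)} {N : ℕ} (hX : CubeCardLE X N)
    {φ : (Fin d → ℤ) → ℝ} (h0 : ∀ k, 0 ≤ φ k) (hφ : Summable φ) (s : Finset X) :
    ∑ x ∈ s, φ (cubeIndex (x : Rd d)) ≤ N * ∑' k, φ k := by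
  classical
  refine (hX.sum_le h0 s (t := s.image fun x : X => cubeIndex (x : Rd d))
    fun x hx => Finset.mem_image_of_mem _ hx).trans ?_
  exact mul_le_mul_of_nonneg_left (hφ.sum_le_tsum _ fun k _ => h0 k) (Nat.cast_nonneg N)

theorem CubeCardLE.summable {d : ℕ} {X : Set (Rd d)} {N : ℕ} (hX : CubeCardLE X N)
    {φ : (Fin d → ℤ) → ℝ} (h0 : ∀ k, 0 ≤ φ k) (hφ : Summable φ) :
    Summable fun x : X => φ (cubeIndex (x : Rd d)) :=
  summable_of_sum_le (fun _ => h0 _) (hX.sum_le_tsum h0 hφ)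

theorem CubeCardLE.tsum_le {d : ℕ} {X : Set (Rd d)} {N : ℕ} (hX : CubeCardLE X N)
    {φ : (Fin d → ℤ) → ℝ} (h0 : ∀ k, 0 ≤ φ k) (hφ : Summable φ) :
    ∑' x : X, φ (cubeIndex (x : Rd d)) ≤ N * ∑' k, φ k :=
  Real.tsum_le_of_sum_le (fun _ => h0 _) (hX.sum_le_tsum h0 hφ)

theorem CubeCardLE.finite_norm_le {d : ℕ} {X : Set (Rd d)} {N : ℕ} (hX : CubeCardLE X N) (R : ℝ) :
    {x : X | ‖(x : Rd d)‖ ≤ R}.Finite := by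
  classical
  set K := (finite_cubeIndex_norm_le d R).toFinset with hK
  by_contra hinf
  obtain ⟨s, hs, hcard⟩ := Set.Infinite.exists_subset_card_eq hinf (N * K.card + 1)
  have := hX.sum_le (φ := fun _ => 1) (fun _ => zero_le_one) s (t := K) fun x hx => by
    simp only [hK, Set.Finite.mem_toFinset, Set.mem_ofPred_eq]
    exact ⟨x, rfl, hs hx⟩
  simp only [Finset.sum_const, nsmul_eq_mul, mul_one, hcard] at this
  have h2 : N * K.card + 1 ≤ N * K.card := by exact_mod_cast this
  omega

theorem CubeCardLE.countable {d : ℕ} {X : Set (Rd d)} {N : ℕ} (hX : CubeCardLE X N) :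
    Countable X := by
  have : (⋃ n : ℕ, {x : X | ‖(x : Rd d)‖ ≤ n}) = Set.univ :=
    Set.eq_univ_of_forall fun x => Set.mem_iUnion.2 (exists_nat_ge ‖(x : Rd d)‖)
  rw [← Set.countable_univ_iff, ← this]
  exact Set.countable_iUnion fun n => (hX.finite_norm_le n).countable

/-! ### The envelope of a localized frame on cubes -/

/-- The points of the translated ball where `|f|` exceeds the essential supremum form an open null
set, hence the empty set. Continuity thus upgrades the almost everywhere envelope to a bound at
every point. -/
theorem norm_le_eLpNorm_envelope {d : ℕ} {f : Rd d → ℂ} (hf : Continuous f) {Θ : Rd d → ℝ}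
    {γ : Rd d} (h : ∀ᵐ x ∂(volume : Measure (Rd d)), ‖f x‖ ≤ Θ (x - γ)) {r : ℝ}
    {w x : Rd d} (hw : x - γ ∈ Metric.ball w r) :
    ‖f x‖ₑ ≤ eLpNorm Θ ∞ (volume.restrict (Metric.ball w r)) := by
  by_contra! hlt
  set c := eLpNorm Θ ∞ (volume.restrict (Metric.ball w r)) with hc
  have h1 : ∀ᵐ z ∂(volume : Measure (Rd d)), z ∈ Metric.ball w r → ‖Θ z‖ₑ ≤ c := by
    rw [← ae_restrict_iff' Metric.isOpen_ball.measurableSet, hc, eLpNorm_exponent_top]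
    exact ae_le_eLpNormEssSup
  have h2 : ∀ᵐ y ∂(volume : Measure (Rd d)), y - γ ∈ Metric.ball w r → ‖Θ (y - γ)‖ₑ ≤ c :=
    (measurePreserving_sub_right volume γ).quasiMeasurePreserving.ae h1
  have hopen : IsOpen ({y : Rd d | c < ‖f y‖ₑ} ∩ {y | y - γ ∈ Metric.ball w r}) :=
    (isOpen_lt continuous_const hf.enorm).inter
      (Metric.isOpen_ball.preimage (continuous_id.sub continuous_const))
  refine (hopen.measure_pos volume ⟨x, hlt, hw⟩).ne' ?_
  have h3 : ∀ᵐ y ∂(volume : Measure (Rd d)),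
      y ∉ {y : Rd d | c < ‖f y‖ₑ} ∩ {y | y - γ ∈ Metric.ball w r} := by
    filter_upwards [h, h2] with y hy hy2 hmem
    have h4 := hy2 hmem.2
    have h5 : ‖f y‖ₑ ≤ ‖Θ (y - γ)‖ₑ := by
      rw [enorm_le_iff_norm_le]
      exact hy.trans (le_abs_self _)
    exact absurd (hmem.1.trans_le h5) (not_lt.2 h4)
  exact measure_eq_zero_iff_ae_notMem.2 h3

/-- If `x - γ` lies within `1/4` of a centre, then `|f x|` is at most `‖Θ‖_{L^∞(B_1(w))}` for every
`w` in the ball of radius `1/4` about that centre, hence at most its average there. Summing these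
averages over a finite cover of the possible differences defines `θ`. For a fixed shift `t` the
balls of radius `1/4` about translated lattice points are disjoint, so the sum over the lattice is
controlled by the amalgam integral. -/
theorem exists_cube_envelope {d : ℕ} {Θ : Rd d → ℝ} (hΘ : MemAmalgam Θ) :
    ∃ θ : (Fin d → ℤ) → ℝ, (∀ m, 0 ≤ θ m) ∧ Summable θ ∧
      ∀ (f : Rd d → ℂ) (γ : Rd d), Continuous f →
        (∀ᵐ x ∂(volume : Measure (Rd d)), ‖f x‖ ≤ Θ (x - γ)) →
        ∀ x, ‖f x‖ ≤ θ (cubeIndex x - cubeIndex γ) := by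
  obtain ⟨T, hT⟩ := exists_finset_cover_closedBall d (show (0 : ℝ) < 1 / 4 by norm_num) (d + 1)
  set g : Rd d → ℝ≥0∞ := fun x => eLpNorm Θ ∞ (volume.restrict (Metric.ball x 1)) with hg
  set v : ℝ≥0∞ := volume (Metric.ball (0 : Rd d) (1 / 4)) with hv
  have hv0 : v ≠ 0 := (Metric.measure_ball_pos volume _ (by norm_num)).ne'
  have hvt : v ≠ ∞ := measure_ball_lt_top.ne
  set θ' : (Fin d → ℤ) → ℝ≥0∞ := fun m =>
    ∑ t ∈ T, v⁻¹ * ∫⁻ w in Metric.ball (latticePoint m + t) (1 / 4), g w with hθ'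
  have hsum : ∑' m, θ' m ≠ ∞ := by
    simp only [hθ']
    rw [Summable.tsum_finsetSum fun _ _ => ENNReal.summable]
    refine (ENNReal.sum_lt_top.2 fun t _ => ?_).ne
    rw [ENNReal.tsum_mul_left, ← lintegral_iUnion]
    · refine ENNReal.mul_lt_top (ENNReal.inv_lt_top.2 (pos_iff_ne_zero.2 hv0)) ?_
      exact (setLIntegral_le_lintegral _ _).trans_lt hΘ.2
    · exact fun m => Metric.isOpen_ball.measurableSet
    · intro k l hkl
      refine Metric.ball_disjoint_ball ?_
      rw [dist_add_right]
      exact le_trans (by norm_num) (one_le_dist_latticePoint hkl)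
  refine ⟨fun m => (θ' m).toReal, fun m => ENNReal.toReal_nonneg, ENNReal.summable_toReal hsum,
    fun f γ hf hfγ x => ?_⟩
  obtain ⟨t, ht, hd⟩ := hT _ (norm_sub_sub_latticePoint_le x γ)
  set m := cubeIndex x - cubeIndex γ
  have h1 : ∀ w ∈ Metric.ball (latticePoint m + t) (1 / 4), ‖f x‖ₑ ≤ g w := by
    intro w hw
    refine norm_le_eLpNorm_envelope hf hfγ ?_
    rw [Metric.mem_ball] at hw ⊢
    have h2 : dist (x - γ) (latticePoint m + t) < 1 / 4 := by
      rw [dist_eq_norm] at hd ⊢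
      rwa [← sub_sub]
    have := dist_triangle_right (x - γ) w (latticePoint m + t)
    linarith
  have h2 : ‖f x‖ₑ * v ≤ ∫⁻ w in Metric.ball (latticePoint m + t) (1 / 4), g w := by
    have h3 : volume (Metric.ball (latticePoint m + t) (1 / 4)) = v := by
      rw [hv, Measure.addHaar_ball_center]
    rw [← h3, ← setLIntegral_const]
    exact setLIntegral_mono' Metric.isOpen_ball.measurableSet h1
  have h3 : ‖f x‖ₑ ≤ θ' m := by
    calc ‖f x‖ₑ = v⁻¹ * (‖f x‖ₑ * v) := by
          rw [mul_comm, mul_assoc, ENNReal.mul_inv_cancel hv0 hvt, mul_one]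
      _ ≤ v⁻¹ * ∫⁻ w in Metric.ball (latticePoint m + t) (1 / 4), g w := by gcongr
      _ ≤ θ' m := Finset.single_le_sum (f := fun t => v⁻¹ *
          ∫⁻ w in Metric.ball (latticePoint m + t) (1 / 4), g w) (fun _ _ => zero_le) ht
  have h4 : θ' m ≠ ∞ := ENNReal.ne_top_of_tsum_ne_top hsum m
  rw [← toReal_enorm]
  exact ENNReal.toReal_mono h4 h3

/-! ### Block decompositions and operators with summable off-diagonal decay -/

/-- A decomposition of a Hilbert space into an orthogonal sum of blocks. -/
structure BlockDecomposition {H ι : Type*} [NormedAddCommGroup H] [InnerProductSpace ℂ H]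
    [DecidableEq ι] (P : ι → H →L[ℂ] H) : Prop where
  inner_left : ∀ k x y, inner ℂ (P k x) y = inner ℂ x (P k y)
  comp : ∀ k l x, P k (P l x) = if k = l then P l x else 0
  hasSum : ∀ x, HasSum (fun k => P k x) x

/-- The block `(k, l)` of `T` has norm at most `ψ (k - l)`, where `ψ` is summable. -/
def IsBlockDominated {H ι : Type*} [NormedAddCommGroup H] [InnerProductSpace ℂ H]
    [AddCommGroup ι] (P : ι → H →L[ℂ] H) (T : H →L[ℂ] H) : Prop :=
  ∃ ψ : ι → ℝ, (∀ m, 0 ≤ ψ m) ∧ Summable ψ ∧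
    ∀ k l x, ‖P k (T (P l x))‖ ≤ ψ (k - l) * ‖P l x‖

namespace IsBlockDominated

variable {H ι : Type*} [NormedAddCommGroup H] [InnerProductSpace ℂ H] [AddCommGroup ι]
  {P : ι → H →L[ℂ] H}

theorem add {T T' : H →L[ℂ] H} (hT : IsBlockDominated P T)
    (hT' : IsBlockDominated P T') : IsBlockDominated P (T + T') := by
  obtain ⟨ψ, h0, hs, h⟩ := hT
  obtain ⟨ψ', h0', hs', h'⟩ := hT'
  refine ⟨fun m => ψ m + ψ' m, fun m => add_nonneg (h0 m) (h0' m), hs.add hs', fun k l x => ?_⟩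
  rw [add_apply, map_add, add_mul]
  exact (norm_add_le _ _).trans (add_le_add (h k l x) (h' k l x))

theorem smul {T : H →L[ℂ] H} (hT : IsBlockDominated P T) (c : ℂ) :
    IsBlockDominated P (c • T) := by
  obtain ⟨ψ, h0, hs, h⟩ := hT
  refine ⟨fun m => ‖c‖ * ψ m, fun m => mul_nonneg (norm_nonneg _) (h0 m), hs.mul_left _,
    fun k l x => ?_⟩
  rw [smul_apply, map_smul, norm_smul, mul_assoc]
  exact mul_le_mul_of_nonneg_left (h k l x) (norm_nonneg _)

theorem sub {T T' : H →L[ℂ] H} (hT : IsBlockDominated P T)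
    (hT' : IsBlockDominated P T') : IsBlockDominated P (T - T') := by
  have : T - T' = T + (-1 : ℂ) • T' := by rw [neg_one_smul, sub_eq_add_neg]
  rw [this]
  exact hT.add (hT'.smul _)

theorem sum {α : Type*} (s : Finset α) {T : α → H →L[ℂ] H}
    (hT : ∀ i ∈ s, IsBlockDominated P (T i)) : IsBlockDominated P (∑ i ∈ s, T i) := by
  classical
  induction s using Finset.induction_on with
  | empty =>
    refine ⟨fun _ => 0, fun _ => le_rfl, summable_zero, fun k l x => ?_⟩
    simp
  | insert a s ha ih =>
    rw [Finset.sum_insert ha]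
    exact (hT a (Finset.mem_insert_self a s)).add
      (ih fun i hi => hT i (Finset.mem_insert_of_mem hi))

end IsBlockDominated

theorem sum_biUnion_le_of_nonneg {α β : Type*} [DecidableEq β] (s : Finset α)
    (t : α → Finset β) {f : β → ℝ} (hf : ∀ b, 0 ≤ f b) :
    ∑ b ∈ s.biUnion t, f b ≤ ∑ a ∈ s, ∑ b ∈ t a, f b := by
  classical
  induction s using Finset.induction_on with
  | empty => simp
  | insert a s ha ih =>
    rw [Finset.biUnion_insert, Finset.sum_insert ha]
    have h := Finset.sum_union_inter (s₁ := t a) (s₂ := s.biUnion t) (f := f)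
    have h2 : 0 ≤ ∑ b ∈ t a ∩ s.biUnion t, f b := Finset.sum_nonneg fun b _ => hf b
    linarith

/-! ### Orthogonality estimates and the algebra of dominated operators -/

namespace BlockDecomposition

section General

variable {H ι : Type*} [NormedAddCommGroup H] [InnerProductSpace ℂ H] [DecidableEq ι]
  {P : ι → H →L[ℂ] H}

theorem norm_sq_sum (hP : BlockDecomposition P) (A : Finset ι) (v : ι → H)
    (hv : ∀ k ∈ A, P k (v k) = v k) : ‖∑ k ∈ A, v k‖ ^ 2 = ∑ k ∈ A, ‖v k‖ ^ 2 := by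
  have h : ∀ k ∈ A, ∀ l ∈ A, inner ℂ (v k) (v l) = if k = l then inner ℂ (v k) (v k) else 0 := by
    intro k hk l hl
    split_ifs with h
    · rw [h]
    · rw [← hv k hk, hP.inner_left, ← hv l hl, hP.comp, if_neg h, inner_zero_right]
  have h2 : (inner ℂ (∑ k ∈ A, v k) (∑ k ∈ A, v k) : ℂ) = ∑ k ∈ A, inner ℂ (v k) (v k) := by
    rw [sum_inner]
    refine Finset.sum_congr rfl fun k hk => ?_
    rw [inner_sum, Finset.sum_congr rfl (h k hk), Finset.sum_ite_eq, if_pos hk]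
  simp only [inner_self_eq_norm_sq_to_K] at h2
  exact_mod_cast h2

theorem idem (hP : BlockDecomposition P) (k : ι) (x : H) : P k (P k x) = P k x := by
  rw [hP.comp, if_pos rfl]

theorem norm_sq_sum_apply (hP : BlockDecomposition P) (A : Finset ι) (x : H) :
    ‖∑ k ∈ A, P k x‖ ^ 2 = ∑ k ∈ A, ‖P k x‖ ^ 2 :=
  hP.norm_sq_sum A (fun k => P k x) fun k _ => hP.idem k x

theorem norm_sum_apply_le (hP : BlockDecomposition P) (A : Finset ι) (x : H) :
    ‖∑ k ∈ A, P k x‖ ≤ ‖x‖ := by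
  have h0 : ‖∑ k ∈ A, P k x‖ ^ 2 ≤ ‖x‖ * ‖∑ k ∈ A, P k x‖ := by
    have h2 : ‖∑ k ∈ A, P k x‖ ^ 2 = RCLike.re (inner ℂ x (∑ k ∈ A, P k x)) := by
      rw [hP.norm_sq_sum_apply, inner_sum, map_sum]
      refine Finset.sum_congr rfl fun k _ => ?_
      rw [← inner_self_eq_norm_sq (𝕜 := ℂ), hP.inner_left, hP.idem]
    rw [h2]
    exact (RCLike.re_le_norm _).trans (norm_inner_le_norm _ _)
  by_contra! h
  nlinarith [norm_nonneg x]

theorem norm_sum_apply_le_of_subset (hP : BlockDecomposition P) {A B : Finset ι} (h : A ⊆ B)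
    (x : H) : ‖∑ k ∈ A, P k x‖ ≤ ‖∑ k ∈ B, P k x‖ := by
  refine (sq_le_sq₀ (norm_nonneg _) (norm_nonneg _)).1 ?_
  rw [hP.norm_sq_sum_apply, hP.norm_sq_sum_apply]
  exact Finset.sum_le_sum_of_subset_of_nonneg h fun _ _ _ => by positivity

theorem apply_sum (hP : BlockDecomposition P) (A : Finset ι) (k : ι) (x : H) :
    P k (∑ l ∈ A, P l x) = if k ∈ A then P k x else 0 := by
  rw [map_sum, Finset.sum_congr rfl fun l _ => hP.comp k l x, Finset.sum_ite_eq]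

end General

section Dominated

variable {H ι : Type*} [NormedAddCommGroup H] [InnerProductSpace ℂ H] [DecidableEq ι]
  [AddCommGroup ι] {P : ι → H →L[ℂ] H}

theorem isBlockDominated_one (hP : BlockDecomposition P) : IsBlockDominated P 1 := by
  refine ⟨fun m => if m = 0 then 1 else 0, fun m => by positivity,
    (hasSum_ite_eq 0 1).summable, fun k l x => ?_⟩
  rw [one_apply_eq_self, hP.comp]
  by_cases h : k = l
  · simp [h]
  · simp [h, sub_eq_zero]

/-- Inserting the resolution of the identity between the two factors dominates the blocks of the
product by the convolution of the two summable sequences. -/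
theorem isBlockDominated_mul (hP : BlockDecomposition P) {T T' : H →L[ℂ] H}
    (hT : IsBlockDominated P T) (hT' : IsBlockDominated P T') : IsBlockDominated P (T * T') := by
  obtain ⟨ψ, h0, hs, h⟩ := hT
  obtain ⟨ψ', h0', hs', h'⟩ := hT'
  have hprod : Summable fun p : ι × ι => ψ (p.1 - p.2) * ψ' p.2 := by
    let e : ι × ι ≃ ι × ι :=
      ⟨fun p => (p.1 - p.2, p.2), fun p => (p.1 + p.2, p.2), fun p => by simp, fun p => by simp⟩
    exact (e.summable_iff (f := fun p : ι × ι => ψ p.1 * ψ' p.2)).2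
      (hs.mul_of_nonneg hs' h0 h0')
  have hrow : ∀ m, Summable fun j => ψ (m - j) * ψ' j := fun m => hprod.prod_factor m
  refine ⟨fun m => ∑' j, ψ (m - j) * ψ' j,
    fun m => tsum_nonneg fun j => mul_nonneg (h0 _) (h0' _), hprod.prod, fun k l x => ?_⟩
  have h1 : HasSum (fun j => P k (T (P j (T' (P l x))))) (P k (T (T' (P l x)))) :=
    ((hP.hasSum (T' (P l x))).mapL T).mapL (P k)
  have h2 : HasSum (fun j => ψ (k - j) * ψ' (j - l)) (∑' j, ψ (k - l - j) * ψ' j) := by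
    rw [← (Equiv.addRight l).hasSum_iff]
    have : ((fun j => ψ (k - j) * ψ' (j - l)) ∘ (Equiv.addRight l)) =
        fun j => ψ (k - l - j) * ψ' j := by
      funext j
      simp only [Function.comp, Equiv.coe_addRight, add_sub_cancel_right]
      congr 2
      abel
    rw [this]
    exact (hrow _).hasSum
  change ‖P k (T (T' (P l x)))‖ ≤ _
  rw [← h1.tsum_eq]
  refine tsum_of_norm_bounded (h2.mul_right ‖P l x‖) fun j => ?_
  refine (h k j (T' (P l x))).trans ?_
  rw [mul_assoc]
  exact mul_le_mul_of_nonneg_left (h' j l x) (h0 _)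

theorem isBlockDominated_pow (hP : BlockDecomposition P) {T : H →L[ℂ] H}
    (hT : IsBlockDominated P T) (n : ℕ) : IsBlockDominated P (T ^ n) := by
  induction n with
  | zero => rw [pow_zero]; exact hP.isBlockDominated_one
  | succ n ih => rw [pow_succ]; exact hP.isBlockDominated_mul ih hT

/-- Minkowski's inequality for the sum of the block diagonals of `T`. -/
theorem norm_sum_apply_le_of_dominated (hP : BlockDecomposition P) {T : H →L[ℂ] H} {ψ : ι → ℝ}
    (hT : ∀ k l x, ‖P k (T (P l x))‖ ≤ ψ (k - l) * ‖P l x‖) (A : Finset ι) (x : H)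
    {ω : ι → ℝ} (hω : Summable ω) {N : ℝ}
    (hN : ∀ m, ψ m ^ 2 * ∑ k ∈ A, ‖P (k - m) x‖ ^ 2 ≤ (ω m * N) ^ 2) (hω0 : ∀ m, 0 ≤ ω m * N) :
    ‖∑ k ∈ A, P k (T x)‖ ≤ (∑' m, ω m) * N := by
  -- Each row is indexed by its diagonal `m = k - l`. For fixed `m` the terms are orthogonal in `k`,
  -- so Pythagoras applies on each diagonal and the triangle inequality across diagonals.
  have h1 : ∀ k, HasSum (fun m => P k (T (P (k - m) x))) (P k (T x)) := by
    intro k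
    exact ((Equiv.subLeft k).hasSum_iff (f := fun l => P k (T (P l x)))).2
      (((hP.hasSum x).mapL T).mapL (P k))
  have h2 := hasSum_sum fun k (_ : k ∈ A) => h1 k
  rw [← h2.tsum_eq]
  refine tsum_of_norm_bounded (hω.hasSum.mul_right N) fun m => ?_
  refine (sq_le_sq₀ (norm_nonneg _) (hω0 m)).1 ?_
  rw [hP.norm_sq_sum A (fun k => P k (T (P (k - m) x))) fun k _ => hP.idem _ _]
  refine le_trans ?_ (hN m)
  rw [Finset.mul_sum]
  refine Finset.sum_le_sum fun k _ => ?_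
  rw [← mul_pow]
  refine pow_le_pow_left₀ (norm_nonneg _) ?_ 2
  simpa using hT k (k - m) x

end Dominated

/-! ### Local norms over large cubes -/

section Cubes

variable {H : Type*} [NormedAddCommGroup H] [InnerProductSpace ℂ H] {d : ℕ}
  {P : (Fin d → ℤ) → H →L[ℂ] H}

/-- The cube of lattice points at sup-distance at most `r` from `k`. -/
noncomputable def latticeCube {d : ℕ} (k : Fin d → ℤ) (r : ℕ) : Finset (Fin d → ℤ) :=
  Finset.Icc (fun i => k i - r) (fun i => k i + r)

theorem mem_latticeCube {d : ℕ} {k l : Fin d → ℤ} {r : ℕ} :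
    l ∈ latticeCube k r ↔ ∀ i, k i - r ≤ l i ∧ l i ≤ k i + r := by
  simp only [latticeCube, Finset.mem_Icc, Pi.le_def]
  exact ⟨fun h i => ⟨h.1 i, h.2 i⟩, fun h => ⟨fun i => (h i).1, fun i => (h i).2⟩⟩

/-- The supremum of the norms of `f` over all cubes of side `2 r + 1`. -/
noncomputable def localNorm (P : (Fin d → ℤ) → H →L[ℂ] H) (r : ℕ) (f : H) : ℝ :=
  ⨆ k, ‖∑ l ∈ latticeCube k r, P l f‖

theorem norm_sum_le_localNorm (hP : BlockDecomposition P) (k : Fin d → ℤ) (r : ℕ) (f : H) :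
    ‖∑ l ∈ latticeCube k r, P l f‖ ≤ localNorm P r f :=
  le_ciSup (f := fun k => ‖∑ l ∈ latticeCube k r, P l f‖)
    ⟨‖f‖, by rintro _ ⟨k, rfl⟩; exact hP.norm_sum_apply_le _ _⟩ k

theorem norm_apply_le_localNorm (hP : BlockDecomposition P) (k : Fin d → ℤ) (r : ℕ) (f : H) :
    ‖P k f‖ ≤ localNorm P r f := by
  refine le_trans ?_ (hP.norm_sum_le_localNorm k r f)
  have h := hP.norm_sum_apply_le_of_subset (A := {k}) (B := latticeCube k r) (by
    rw [Finset.singleton_subset_iff, mem_latticeCube]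
    intro i
    constructor <;> simp) f
  simpa using h

theorem localNorm_nonneg (P : (Fin d → ℤ) → H →L[ℂ] H) (r : ℕ) (f : H) : 0 ≤ localNorm P r f :=
  Real.iSup_nonneg fun _ => norm_nonneg _

theorem localNorm_le (hP : BlockDecomposition P) (r : ℕ) (f : H) : localNorm P r f ≤ ‖f‖ :=
  ciSup_le fun _ => hP.norm_sum_apply_le _ _

theorem localNorm_add_le (hP : BlockDecomposition P) (r : ℕ) (f g : H) :
    localNorm P r (f + g) ≤ localNorm P r f + localNorm P r g := by
  refine ciSup_le fun k => ?_
  simp only [map_add, Finset.sum_add_distrib]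
  exact (norm_add_le _ _).trans
    (add_le_add (hP.norm_sum_le_localNorm k r f) (hP.norm_sum_le_localNorm k r g))

theorem latticeCube_two_mul_subset (k : Fin d → ℤ) (r : ℕ) :
    latticeCube k (2 * r) ⊆
      (latticeCube (0 : Fin d → ℤ) 1).biUnion fun t => latticeCube (k + (r : ℤ) • t) r := by
  intro l hl
  rw [mem_latticeCube] at hl
  rw [Finset.mem_biUnion]
  -- In each coordinate the interval of radius `2r` is covered by the intervals of radius `r`
  -- centred at `k i - r`, `k i` and `k i + r`.
  refine ⟨fun i => if l i < k i - r then -1 else if k i + r < l i then 1 else 0, ?_, ?_⟩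
  · rw [mem_latticeCube]
    intro i
    dsimp only [Pi.zero_apply]
    split_ifs <;> simp
  · rw [mem_latticeCube]
    intro i
    have := hl i
    push_cast at this
    simp only [Pi.add_apply, Pi.smul_apply, smul_eq_mul]
    split_ifs <;> constructor <;> linarith

theorem norm_sum_two_mul_le (hP : BlockDecomposition P) (k : Fin d → ℤ) (r : ℕ) (f : H) :
    ‖∑ l ∈ latticeCube k (2 * r), P l f‖ ≤
      (latticeCube (0 : Fin d → ℤ) 1).card * localNorm P r f := by
  set K := latticeCube (0 : Fin d → ℤ) 1
  have hK : 1 ≤ (K.card : ℝ) := by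
    have : 0 < K.card := Finset.card_pos.2 ⟨0, mem_latticeCube.2 fun i => by simp⟩
    exact_mod_cast this
  have hN := localNorm_nonneg P r f
  refine (sq_le_sq₀ (norm_nonneg _) (by positivity)).1 ?_
  calc ‖∑ l ∈ latticeCube k (2 * r), P l f‖ ^ 2
      = ∑ l ∈ latticeCube k (2 * r), ‖P l f‖ ^ 2 := hP.norm_sq_sum_apply _ _
    _ ≤ ∑ l ∈ K.biUnion fun t => latticeCube (k + (r : ℤ) • t) r, ‖P l f‖ ^ 2 :=
        Finset.sum_le_sum_of_subset_of_nonneg (latticeCube_two_mul_subset k r)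
          fun _ _ _ => by positivity
    _ ≤ ∑ t ∈ K, ∑ l ∈ latticeCube (k + (r : ℤ) • t) r, ‖P l f‖ ^ 2 :=
        sum_biUnion_le_of_nonneg _ _ fun _ => by positivity
    _ ≤ ∑ _t ∈ K, localNorm P r f ^ 2 := by
        refine Finset.sum_le_sum fun t _ => ?_
        rw [← hP.norm_sq_sum_apply]
        exact pow_le_pow_left₀ (norm_nonneg _) (hP.norm_sum_le_localNorm _ r f) 2
    _ = K.card * localNorm P r f ^ 2 := by rw [Finset.sum_const, nsmul_eq_mul]
    _ ≤ (K.card * localNorm P r f) ^ 2 := by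
        rw [mul_pow]
        refine mul_le_mul_of_nonneg_right ?_ (by positivity)
        nlinarith

/-- On a cube of radius `r`, split `f` into its part `f₁` on the concentric cube of radius `2r` and
the rest. The first part costs the operator norm times the number of small cubes covering the large
one, a factor independent of `r`. The rest is reached only through diagonals `m` outside the cube of
radius `r`, whose total weight is a tail of `ψ`. -/
theorem localNorm_apply_le (hP : BlockDecomposition P) {T : H →L[ℂ] H} {ψ : (Fin d → ℤ) → ℝ}
    (h0 : ∀ m, 0 ≤ ψ m) (hψ : Summable ψ)
    (hT : ∀ k l x, ‖P k (T (P l x))‖ ≤ ψ (k - l) * ‖P l x‖) (r : ℕ) (f : H) :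
    localNorm P r (T f) ≤ ((latticeCube (0 : Fin d → ℤ) 1).card * ‖T‖ +
      ∑' m, if m ∈ latticeCube 0 r then 0 else ψ m) * localNorm P r f := by
  set K := latticeCube (0 : Fin d → ℤ) 1
  have hN := localNorm_nonneg P r f
  refine ciSup_le fun k => ?_
  set f₁ := ∑ l ∈ latticeCube k (2 * r), P l f with hf₁
  have hsplit : ∑ l ∈ latticeCube k r, P l (T f) =
      ∑ l ∈ latticeCube k r, P l (T f₁) + ∑ l ∈ latticeCube k r, P l (T (f - f₁)) := by
    rw [← Finset.sum_add_distrib]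
    refine Finset.sum_congr rfl fun l _ => ?_
    rw [← map_add, ← map_add, add_sub_cancel]
  rw [hsplit, add_mul]
  refine (norm_add_le _ _).trans (add_le_add ?_ ?_)
  · calc ‖∑ l ∈ latticeCube k r, P l (T f₁)‖ ≤ ‖T f₁‖ := hP.norm_sum_apply_le _ _
      _ ≤ ‖T‖ * ‖f₁‖ := T.le_opNorm _
      _ ≤ ‖T‖ * (K.card * localNorm P r f) :=
          mul_le_mul_of_nonneg_left (hP.norm_sum_two_mul_le k r f) (norm_nonneg _)
      _ = K.card * ‖T‖ * localNorm P r f := by ring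
  · have hPf : ∀ l, P l (f - f₁) = if l ∈ latticeCube k (2 * r) then 0 else P l f := by
      intro l
      rw [map_sub, hf₁, hP.apply_sum]
      split_ifs <;> simp
    have hnn : ∀ m, 0 ≤ (if m ∈ latticeCube 0 r then 0 else ψ m : ℝ) := fun m => by
      split_ifs
      exacts [le_rfl, h0 m]
    refine hP.norm_sum_apply_le_of_dominated hT _ _
      (hψ.of_nonneg_of_le hnn fun m => ?_) (fun m => ?_) fun m => mul_nonneg (hnn m) hN
    · split_ifs
      exacts [h0 m, le_rfl]
    · split_ifs with hm
      -- Such a diagonal links the cube of radius `r` only to the cube of radius `2r`, on which `f -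
      -- f₁` vanishes.
      · have : ∑ l ∈ latticeCube k r, ‖P (l - m) (f - f₁)‖ ^ 2 = 0 := by
          refine Finset.sum_eq_zero fun l hl => ?_
          rw [hPf, if_pos, norm_zero, zero_pow two_ne_zero]
          rw [mem_latticeCube] at hl hm ⊢
          intro i
          have h1 := hl i
          have h2 := hm i
          simp only [Pi.zero_apply, Pi.sub_apply] at h2 ⊢
          push_cast
          constructor <;> linarith
        rw [this]
        simp
      · rw [mul_pow]
        refine mul_le_mul_of_nonneg_left ?_ (by positivity)
        have h1 : ∑ l ∈ latticeCube k r, ‖P (l - m) (f - f₁)‖ ^ 2 ≤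
            ∑ l ∈ latticeCube k r, ‖P (l - m) f‖ ^ 2 := by
          refine Finset.sum_le_sum fun l _ => ?_
          rw [hPf]
          split_ifs
          · simp
          · exact le_rfl
        refine h1.trans ?_
        have h2 : ∑ l ∈ latticeCube k r, ‖P (l - m) f‖ ^ 2 =
            ∑ l ∈ latticeCube (k - m) r, ‖P l f‖ ^ 2 := by
          refine Finset.sum_bij' (fun l _ => l - m) (fun l _ => l + m) ?_ ?_ ?_ ?_ ?_
          · intro l hl
            rw [mem_latticeCube] at hl ⊢
            intro i
            have := hl i
            simp only [Pi.sub_apply]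
            constructor <;> linarith
          · intro l hl
            rw [mem_latticeCube] at hl ⊢
            intro i
            have := hl i
            simp only [Pi.sub_apply, Pi.add_apply] at this ⊢
            constructor <;> linarith
          · intro l _; simp
          · intro l _; simp
          · intro l _; rfl
        rw [h2, ← hP.norm_sq_sum_apply]
        exact pow_le_pow_left₀ (norm_nonneg _) (hP.norm_sum_le_localNorm _ r f) 2

theorem exists_localNorm_apply_le (hP : BlockDecomposition P) {T : H →L[ℂ] H}
    (hT : IsBlockDominated P T) (r : ℕ) :
    ∃ C : ℝ, 0 ≤ C ∧ ∀ f, localNorm P r (T f) ≤ C * localNorm P r f := by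
  obtain ⟨ψ, h0, hψ, hT⟩ := hT
  refine ⟨_, ?_, hP.localNorm_apply_le h0 hψ hT r⟩
  have : 0 ≤ ∑' m, if m ∈ latticeCube 0 r then 0 else ψ m := tsum_nonneg fun m => by
    split_ifs
    exacts [le_rfl, h0 m]
  positivity

/-- The tail of `ψ` is the only term of `localNorm_apply_le` that depends on `r`, and it tends to
zero. Smallness in the Hilbert space norm therefore transfers to the local norm on large cubes. -/
theorem exists_localNorm_apply_le_of_small (hP : BlockDecomposition P) {T : H →L[ℂ] H}
    (hT : IsBlockDominated P T) {τ : ℝ}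
    (hτ : (latticeCube (0 : Fin d → ℤ) 1).card * ‖T‖ < τ) :
    ∃ r : ℕ, ∀ f, localNorm P r (T f) ≤ τ * localNorm P r f := by
  obtain ⟨ψ, h0, hψ, hT⟩ := hT
  obtain ⟨s, hs⟩ := ((tendsto_order.1 (tendsto_tsum_compl_atTop_zero ψ)).2 _
    (sub_pos.2 hτ)).exists
  obtain ⟨r, hr⟩ : ∃ r : ℕ, ∀ m ∈ s, m ∈ latticeCube 0 r := by
    refine ⟨∑ m ∈ s, ∑ i, (m i).natAbs, fun m hm => mem_latticeCube.2 fun i => ?_⟩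
    have h1 : (m i).natAbs ≤ ∑ m ∈ s, ∑ i, (m i).natAbs :=
      (Finset.single_le_sum (f := fun i => (m i).natAbs) (fun _ _ => Nat.zero_le _)
        (Finset.mem_univ i)).trans
      (Finset.single_le_sum (f := fun m => ∑ i, (m i).natAbs) (fun _ _ => Nat.zero_le _) hm)
    simp only [Pi.zero_apply]
    omega
  refine ⟨r, fun f => (hP.localNorm_apply_le h0 hψ hT r f).trans
    (mul_le_mul_of_nonneg_right ?_ (localNorm_nonneg P r f))⟩
  have h1 : (∑' m, if m ∈ latticeCube 0 r then 0 else ψ m) ≤ ∑' m : {m // m ∉ s}, ψ m := by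
    have h2 : ∑' m : {m // m ∉ s}, ψ m = ∑' m, Set.indicator {m | m ∉ s} ψ m :=
      tsum_subtype {m | m ∉ s} ψ
    rw [h2]
    have h3 : ∀ m, (if m ∈ latticeCube 0 r then 0 else ψ m) ≤ Set.indicator {m | m ∉ s} ψ m := by
      intro m
      by_cases hm : m ∈ s
      · rw [if_pos (hr m hm)]
        exact Set.indicator_nonneg (fun m _ => h0 m) m
      · rw [Set.indicator_of_mem (by exact hm)]
        split_ifs
        exacts [h0 m, le_rfl]
    have h4 : Summable (Set.indicator {m | m ∉ s} ψ) := hψ.indicator _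
    refine Summable.tsum_le_tsum h3 (h4.of_nonneg_of_le (fun m => ?_) h3) h4
    split_ifs
    exacts [le_rfl, h0 m]
  linarith

end Cubes

end BlockDecomposition

/-- A three-term inequality together with moderate growth bounds the ratio of consecutive terms. -/
theorem le_two_mul_of_three_term {b : ℕ → ℝ} {K : ℝ}
    (h : ∀ i, b (i + 1) ≤ b i + 1 / 8 * b (i + 2)) (h0 : ∀ i, 0 ≤ b i)
    (hK : ∀ i, b i ≤ K * (3 / 2) ^ i) : b 1 ≤ 2 * b 0 := by
  have hK0 : 0 ≤ K := by simpa using (h0 0).trans (hK 0)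
  -- The recursion `t = 1 + t²/8` has roots `4 ± 2√2`, and growth at rate `3/2` excludes the larger
  -- one. Inserting the bound for `i + 1` into the inequality for `i` gives `(3/4) b (i+1) ≤ b i +
  -- (3/8) K (1/4)^n (3/2)^i`, so the error shrinks by the factor `1/4` at each round.
  have key : ∀ n i : ℕ, b (i + 1) ≤ 2 * b i + 2 * K * (1 / 4) ^ n * (3 / 2) ^ i := by
    intro n
    induction n with
    | zero =>
      intro i
      have h1 := hK (i + 1)
      have h2 : 0 ≤ K * (3 / 2) ^ i := by positivity
      rw [pow_succ] at h1
      have := h0 i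
      rw [pow_zero]
      linarith
    | succ n ih =>
      intro i
      have h1 := ih (i + 1)
      have h2 := h i
      have h3 := h0 i
      have h4 : 0 ≤ K * (1 / 4) ^ n * (3 / 2) ^ i := by positivity
      rw [pow_succ (3 / 2 : ℝ)] at h1
      rw [pow_succ (1 / 4 : ℝ)]
      have h5 : b (i + 1 + 1) = b (i + 2) := rfl
      rw [h5] at h1
      linarith
  have h1 : Tendsto (fun n : ℕ => 2 * b 0 + 2 * K * (1 / 4) ^ n * (3 / 2) ^ 0) atTop
      (𝓝 (2 * b 0 + 2 * K * 0 * (3 / 2) ^ 0)) := by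
    refine tendsto_const_nhds.add (((tendsto_pow_atTop_nhds_zero_of_lt_one ?_ ?_).const_mul
      _).mul_const _) <;> norm_num
  have := ge_of_tendsto' h1 fun n => key n 0
  simpa using this

/-! ### Stability of localized frame operators in the local norm -/

/-- Neumann series inside `V`; the constant is `1 / (1 - 1/3) = 3/2`, the growth rate allowed in
`le_two_mul_of_three_term`. -/
theorem Submodule.exists_sub_eq_of_contraction {H : Type*} [NormedAddCommGroup H]
    [InnerProductSpace ℂ H] [CompleteSpace H] {V : Submodule ℂ H} (hV : IsClosed (V : Set H))
    {w : H →L[ℂ] H} (hwV : ∀ v ∈ V, w v ∈ V) (hw : ∀ v ∈ V, ‖w v‖ ≤ 1 / 3 * ‖v‖)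
    {x : H} (hx : x ∈ V) : ∃ y ∈ V, y - w y = x ∧ ‖y‖ ≤ 3 / 2 * ‖x‖ := by
  have hmem : ∀ n : ℕ, (w ^ n) x ∈ V := by
    intro n
    induction n with
    | zero => simpa using hx
    | succ n ih => rw [pow_succ']; exact hwV _ ih
  have hnorm : ∀ n : ℕ, ‖(w ^ n) x‖ ≤ (1 / 3) ^ n * ‖x‖ := by
    intro n
    induction n with
    | zero => simp
    | succ n ih =>
      rw [pow_succ', pow_succ', mul_assoc]
      exact (hw _ (hmem n)).trans (mul_le_mul_of_nonneg_left ih (by norm_num))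
  have hg : HasSum (fun n : ℕ => (1 / 3 : ℝ) ^ n * ‖x‖) (3 / 2 * ‖x‖) := by
    have := (hasSum_geometric_of_lt_one (r := (1 / 3 : ℝ)) (by norm_num) (by norm_num)).mul_right ‖x‖
    convert! this using 2
    norm_num
  have hs : Summable fun n => (w ^ n) x := Summable.of_norm_bounded hg.summable hnorm
  refine ⟨∑' n, (w ^ n) x, ?_, ?_, tsum_of_norm_bounded hg hnorm⟩
  · exact hV.mem_of_tendsto hs.hasSum (Eventually.of_forall fun s => V.sum_mem fun n _ => hmem n)
  · have h1 : w (∑' n, (w ^ n) x) = ∑' n, (w ^ (n + 1)) x := by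
      rw [w.map_tsum hs]
      refine tsum_congr fun n => ?_
      rw [pow_succ']
      rfl
    rw [h1, hs.tsum_eq_zero_add]
    simp

/-- Stability of `S` on `V` passes from the Hilbert space norm to a local norm. A Neumann series
cannot be summed directly in the local norm, since `w` is small only on `V` while local truncations
leave `V`. The operator `w(1-w)` is small everywhere, and the three-term inequality replaces the
Neumann series. -/
theorem BlockDecomposition.exists_localNorm_solution {H : Type*} [NormedAddCommGroup H]
    [InnerProductSpace ℂ H] [CompleteSpace H] {d : ℕ} {P : (Fin d → ℤ) → H →L[ℂ] H}
    (hP : BlockDecomposition P) {S : H →L[ℂ] H} (hS : IsBlockDominated P S) {V : Submodule ℂ H}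
    (hV : IsClosed (V : Set H)) (hSV : ∀ f, S f ∈ V) (hS0 : ∀ f ∈ Vᗮ, S f = 0) {A B : ℝ}
    (hA : 0 < A) (hAB : A ≤ B) (hpos : ∀ f ∈ V, A * ‖f‖ ^ 2 ≤ RCLike.re (inner ℂ (S f) f))
    (hsq : ∀ f, ‖S f‖ ^ 2 ≤ B * RCLike.re (inner ℂ (S f) f)) :
    ∃ (r : ℕ) (C : ℝ), 0 ≤ C ∧
      ∀ f ∈ V, ∃ g ∈ V, S g = f ∧ localNorm P r g ≤ C * localNorm P r f := by
  have hB : 0 < B := hA.trans_le hAB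
  set u : H →L[ℂ] H := 1 - ((B⁻¹ : ℝ) : ℂ) • S with hu
  set ρ : ℝ := √(1 - A / B) with hρ
  have hρ0 : 0 ≤ ρ := Real.sqrt_nonneg _
  have hAB1 : A / B ≤ 1 := (div_le_one hB).2 hAB
  have hρ1 : ρ < 1 := by
    rw [hρ, Real.sqrt_lt' one_pos]
    have : 0 < A / B := by positivity
    linarith
  have huV : ∀ v ∈ V, u v ∈ V := fun v hv => V.sub_mem hv (V.smul_mem _ (hSV v))
  have hu1 : ∀ v ∈ V, ‖u v‖ ≤ ρ * ‖v‖ := by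
    intro v hv
    refine (sq_le_sq₀ (norm_nonneg _) (by positivity)).1 ?_
    have h1 : u v = v - ((B⁻¹ : ℝ) : ℂ) • S v := rfl
    rw [h1, @norm_sub_sq ℂ, inner_smul_right, norm_smul, mul_pow, mul_pow, hρ,
      Real.sq_sqrt (by linarith), Complex.norm_real, Real.norm_of_nonneg (inv_nonneg.2 hB.le)]
    have h2 : RCLike.re (((B⁻¹ : ℝ) : ℂ) * inner ℂ v (S v)) =
        B⁻¹ * RCLike.re (inner ℂ (S v) v) := by
      rw [← inner_re_symm (𝕜 := ℂ) v (S v)]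
      simp
    rw [h2]
    set t := RCLike.re (inner ℂ (S v) v)
    -- Expanding the square, `‖u v‖² ≤ ‖v‖² - t/B ≤ (1 - A/B) ‖v‖²`, which is the origin of `ρ`.
    have h3 : B⁻¹ ^ 2 * ‖S v‖ ^ 2 ≤ B⁻¹ * t := by
      calc B⁻¹ ^ 2 * ‖S v‖ ^ 2 ≤ B⁻¹ ^ 2 * (B * t) := by gcongr; exact hsq v
        _ = B⁻¹ * t := by field_simp
    have h4 : B⁻¹ * (A * ‖v‖ ^ 2) ≤ B⁻¹ * t := by gcongr; exact hpos v hv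
    have h5 : A / B * ‖v‖ ^ 2 = B⁻¹ * (A * ‖v‖ ^ 2) := by ring
    linarith
  have hpowV : ∀ (n : ℕ), ∀ v ∈ V, (u ^ n) v ∈ V := by
    intro n v hv
    induction n with
    | zero => simpa using hv
    | succ n ih => rw [pow_succ']; exact huV _ ih
  have hpow : ∀ (n : ℕ), ∀ v ∈ V, ‖(u ^ n) v‖ ≤ ρ ^ n * ‖v‖ := by
    intro n v hv
    induction n with
    | zero => simp
    | succ n ih =>
      rw [pow_succ', pow_succ', mul_assoc]
      exact (hu1 _ (hpowV n v hv)).trans (mul_le_mul_of_nonneg_left ih hρ0)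
  have hpow0 : ∀ (n : ℕ), ∀ v ∈ Vᗮ, (u ^ n) v = v := by
    intro n v hv
    induction n with
    | zero => simp
    | succ n ih =>
      rw [pow_succ']
      change u ((u ^ n) v) = v
      rw [ih]
      change v - ((B⁻¹ : ℝ) : ℂ) • S v = v
      rw [hS0 v hv, smul_zero, sub_zero]
  set K : ℝ := ((BlockDecomposition.latticeCube (0 : Fin d → ℤ) 1).card : ℝ) with hK
  -- The first condition makes `w = u ^ m` a contraction by `1/3` on `V`; the second makes the local
  -- norm of `w(1-w)` at most `1/8` on large cubes.
  obtain ⟨m, hm1, hm2⟩ : ∃ m : ℕ, ρ ^ m < 1 / 3 ∧ K * (2 * ρ ^ m) < 1 / 8 := by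
    have h1 := tendsto_pow_atTop_nhds_zero_of_lt_one hρ0 hρ1
    have h2 : Tendsto (fun n : ℕ => K * (2 * ρ ^ n)) atTop (𝓝 (K * (2 * 0))) :=
      (h1.const_mul 2).const_mul K
    rw [mul_zero, mul_zero] at h2
    exact (((tendsto_order.1 h1).2 _ (by norm_num)).and
      ((tendsto_order.1 h2).2 _ (by norm_num))).exists
  set w := u ^ m with hw
  -- On `Vᗮ` the operator `w` is the identity, so the factor `1 - w` annihilates that component and
  -- only the small part on `V` remains.
  have hnorm : ‖w * (1 - w)‖ ≤ 2 * ρ ^ m := by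
    refine ContinuousLinearMap.opNorm_le_bound _ (by positivity) fun x => ?_
    have : CompleteSpace V := hV.completeSpace_coe
    obtain ⟨v, hv, z, hz, rfl⟩ := V.exists_add_mem_mem_orthogonal x
    have h1 : (w * (1 - w)) (v + z) = w v - w (w v) := by
      change w ((v + z) - w (v + z)) = _
      rw [map_add w v z, hpow0 m z hz, add_sub_add_right_eq_sub, map_sub]
    have h2 : ‖v‖ ≤ ‖v + z‖ := by
      have := norm_add_sq_eq_norm_sq_add_norm_sq_of_inner_eq_zero v z
        (V.inner_right_of_mem_orthogonal hv hz)
      nlinarith [norm_nonneg v, norm_nonneg (v + z), norm_nonneg z]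
    have h3 := hpow m v hv
    have h4 := hpow m _ (hpowV m v hv)
    have h5 : ρ ^ m * ‖w v‖ ≤ ‖w v‖ := by
      have := norm_nonneg (w v)
      nlinarith
    calc ‖(w * (1 - w)) (v + z)‖ ≤ ‖w v‖ + ‖w (w v)‖ := by rw [h1]; exact norm_sub_le _ _
      _ ≤ 2 * (ρ ^ m * ‖v‖) := by linarith
      _ ≤ 2 * ρ ^ m * ‖v + z‖ := by rw [← mul_assoc]; gcongr
  have hone := hP.isBlockDominated_one
  have hdu : IsBlockDominated P u := hone.sub (hS.smul _)
  have hdw : IsBlockDominated P w := hP.isBlockDominated_pow hdu m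
  obtain ⟨r, hr⟩ := hP.exists_localNorm_apply_le_of_small
    (hP.isBlockDominated_mul hdw (hone.sub hdw)) (τ := 1 / 8)
    (lt_of_le_of_lt (mul_le_mul_of_nonneg_left hnorm (Nat.cast_nonneg _)) hm2)
  -- By the geometric sum `S s = 1 - w`, so solving `S g = f` reduces to inverting `1 - w` on `V`,
  -- and `s` is bounded in the local norm.
  set s : H →L[ℂ] H := ((B⁻¹ : ℝ) : ℂ) • ∑ n ∈ Finset.range m, u ^ n with hs
  have hds : IsBlockDominated P s :=
    (IsBlockDominated.sum _ fun n _ => hP.isBlockDominated_pow hdu n).smul _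
  obtain ⟨C, hC0, hC⟩ := hP.exists_localNorm_apply_le hds r
  have hSs : ∀ x, S (s x) = x - w x := by
    intro x
    have h1 : S * s = 1 - w := by
      rw [hw, ← mul_neg_geom_sum, hs, hu, sub_sub_cancel, mul_smul_comm, smul_mul_assoc]
    exact congrArg (fun T : H →L[ℂ] H => T x) h1
  have hsV : ∀ v ∈ V, s v ∈ V := by
    intro v hv
    rw [hs, smul_apply, sum_apply]
    exact V.smul_mem _ (V.sum_mem fun n _ => hpowV n v hv)
  refine ⟨r, C * 2, by positivity, fun f hf => ?_⟩
  have hsol : ∀ x : V, ∃ y : V, (y : H) - w y = x ∧ ‖(y : H)‖ ≤ 3 / 2 * ‖(x : H)‖ := by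
    intro x
    obtain ⟨y, hy, h1, h2⟩ := Submodule.exists_sub_eq_of_contraction hV (hpowV m)
      (fun v hv => (hpow m v hv).trans (by gcongr)) x.2
    exact ⟨⟨y, hy⟩, h1, h2⟩
  choose inv hinv1 hinv2 using hsol
  let z : ℕ → V := fun n => inv^[n] ⟨f, hf⟩
  have hz : ∀ n, z (n + 1) = inv (z n) := fun n => Function.iterate_succ_apply' _ _ _
  have hz1 : ∀ n, (z (n + 1) : H) - w (z (n + 1)) = z n := fun n => by rw [hz]; exact hinv1 _
  have hgrow : ∀ n, ‖(z n : H)‖ ≤ ‖f‖ * (3 / 2) ^ n := by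
    intro n
    induction n with
    | zero => simp [z]
    | succ n ih =>
      have := hinv2 (z n)
      rw [hz, pow_succ]
      linarith
  have hb : localNorm P r (z 1 : H) ≤ 2 * localNorm P r (z 0 : H) := by
    refine le_two_mul_of_three_term (b := fun n => localNorm P r (z n : H)) (K := ‖f‖)
      (fun i => ?_) (fun i => localNorm_nonneg P r _)
      fun i => (hP.localNorm_le r _).trans (hgrow i)
    -- Here `z_{i+1} = z_i + w z_{i+1}` and `z_{i+1} = (1-w) z_{i+2}`.
    have h1 : (z (i + 1) : H) = z i + (w * (1 - w)) (z (i + 2)) := by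
      have h2 : (w * (1 - w)) (z (i + 2) : H) = w ((z (i + 2) : H) - w (z (i + 2))) := rfl
      rw [h2, hz1 (i + 1), ← hz1 i, sub_add_cancel]
    calc localNorm P r (z (i + 1) : H)
        = localNorm P r ((z i : H) + (w * (1 - w)) (z (i + 2))) := by rw [← h1]
      _ ≤ _ := (hP.localNorm_add_le r _ _).trans (add_le_add_right (hr _) _)
  refine ⟨s (z 1), hsV _ (z 1).2, ?_, ?_⟩
  · rw [hSs, hz1 0]
    rfl
  · calc localNorm P r (s (z 1)) ≤ C * localNorm P r (z 1 : H) := hC _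
      _ ≤ C * (2 * localNorm P r (z 0 : H)) := by gcongr
      _ = C * 2 * localNorm P r f := by rw [mul_assoc]; rfl

/-! ### Bounded coefficients for localized frames -/

/-- The block `(k, l)` is at most `∑_γ θ(k-γ) θ(l-γ)`. Counting nodes per cube bounds this by `N`
times the autocorrelation of `θ` at `k - l`, which is summable. -/
theorem isBlockDominated_frameOperator {H : Type*} [NormedAddCommGroup H]
    [InnerProductSpace ℂ H] {d : ℕ} {P : (Fin d → ℤ) → H →L[ℂ] H}
    (hP : BlockDecomposition P) {X : Set (Rd d)} {N : ℕ} (hX : CubeCardLE X N)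
    {θ : (Fin d → ℤ) → ℝ} (hθ0 : ∀ m, 0 ≤ θ m) (hθ : Summable θ) {φ : X → H}
    (hφ : ∀ k γ, ‖P k (φ γ)‖ ≤ θ (k - cubeIndex (γ : Rd d))) {S : H →L[ℂ] H}
    (hS : ∀ f, HasSum (fun γ => (inner ℂ (φ γ) f : ℂ) • φ γ) (S f)) : IsBlockDominated P S := by
  have hprod : Summable fun p : (Fin d → ℤ) × (Fin d → ℤ) => θ (p.1 + p.2) * θ p.2 := by
    let e : (Fin d → ℤ) × (Fin d → ℤ) ≃ (Fin d → ℤ) × (Fin d → ℤ) :=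
      ⟨fun p => (p.1 + p.2, p.2), fun p => (p.1 - p.2, p.2), fun p => by simp, fun p => by simp⟩
    exact (e.summable_iff (f := fun p : (Fin d → ℤ) × (Fin d → ℤ) => θ p.1 * θ p.2)).2
      (hθ.mul_of_nonneg hθ hθ0 hθ0)
  refine ⟨fun m => N * ∑' j, θ (m + j) * θ j, fun m => mul_nonneg (Nat.cast_nonneg _)
    (tsum_nonneg fun j => mul_nonneg (hθ0 _) (hθ0 _)), hprod.prod.mul_left _, fun k l x => ?_⟩
  have h0 : ∀ j, 0 ≤ θ (k - j) * θ (l - j) := fun j => mul_nonneg (hθ0 _) (hθ0 _)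
  have h1 : HasSum (fun j => θ (k - j) * θ (l - j)) (∑' j, θ (k - l + j) * θ j) := by
    rw [← (Equiv.subLeft l).hasSum_iff]
    have : ((fun j => θ (k - j) * θ (l - j)) ∘ (Equiv.subLeft l)) =
        fun j => θ (k - l + j) * θ j := by
      funext j
      simp only [Function.comp, Equiv.subLeft_apply, sub_sub_cancel]
      congr 2
      abel
    rw [this]
    exact (hprod.prod_factor _).hasSum
  have h2 := (hS (P l x)).mapL (P k)
  rw [← h2.tsum_eq]
  have h3 := hX.summable h0 h1.summable
  have h4 := hX.tsum_le h0 h1.summable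
  rw [h1.tsum_eq] at h4
  refine (tsum_of_norm_bounded (h3.hasSum.mul_right ‖P l x‖) fun γ => ?_).trans
    (mul_le_mul_of_nonneg_right h4 (norm_nonneg _))
  rw [map_smul, norm_smul]
  have h5 : ‖(inner ℂ (φ γ) (P l x) : ℂ)‖ ≤ θ (l - cubeIndex (γ : Rd d)) * ‖P l x‖ := by
    rw [← hP.idem l x, ← hP.inner_left, hP.idem]
    exact (norm_inner_le_norm _ _).trans (mul_le_mul_of_nonneg_right (hφ l γ) (norm_nonneg _))
  calc _ ≤ θ (l - cubeIndex (γ : Rd d)) * ‖P l x‖ * θ (k - cubeIndex (γ : Rd d)) :=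
        mul_le_mul h5 (hφ k γ) (norm_nonneg _) (mul_nonneg (hθ0 _) (norm_nonneg _))
    _ = _ := by ring

section Frame

variable {H : Type*} [NormedAddCommGroup H] [InnerProductSpace ℂ H] [CompleteSpace H]

/-- The frame inequalities hold only on `V`, but the `φ γ` lie in `V`, so inner products with them
see only the projection to `V`. This defines the operator on all of `H`, where the block
decomposition lives. -/
theorem exists_analysis_operator {Γ : Type*} {φ : Γ → H} {V : Submodule ℂ H}
    (hV : IsClosed (V : Set H)) (hφ : ∀ γ, φ γ ∈ V) {B : ℝ} (hB : 0 ≤ B)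
    (hsum : ∀ f ∈ V, Summable fun γ => ‖inner ℂ (φ γ) f‖ ^ 2)
    (hle : ∀ f ∈ V, ∑' γ, ‖inner ℂ (φ γ) f‖ ^ 2 ≤ B * ‖f‖ ^ 2) :
    ∃ C : H →L[ℂ] lp (fun _ : Γ => ℂ) 2, (∀ f γ, C f γ = inner ℂ (φ γ) f) ∧
      ‖C‖ ≤ √B ∧ ∀ f, ‖C f‖ ^ 2 = ∑' γ, ‖inner ℂ (φ γ) f‖ ^ 2 := by
  have : CompleteSpace V := hV.completeSpace_coe
  have hproj : ∀ γ f, inner ℂ (φ γ) f = inner ℂ (φ γ) (V.starProjection f) := by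
    intro γ f
    rw [← sub_eq_zero, ← inner_sub_right]
    exact V.inner_right_of_mem_orthogonal (hφ γ) (V.sub_starProjection_mem_orthogonal f)
  have hmem : ∀ f, Memℓp (fun γ => (inner ℂ (φ γ) f : ℂ)) 2 := by
    intro f
    refine memℓp_gen ?_
    simp only [hproj _ f]
    simpa using hsum _ (V.starProjection_apply_mem f)
  let C₀ : H →ₗ[ℂ] lp (fun _ : Γ => ℂ) 2 :=
    { toFun := fun f => ⟨fun γ => inner ℂ (φ γ) f, hmem f⟩
      map_add' := fun f g => by ext γ; exact inner_add_right _ _ _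
      map_smul' := fun c f => by ext γ; exact inner_smul_right _ _ _ }
  have hC₀ : ∀ f, ‖C₀ f‖ ^ 2 = ∑' γ, ‖inner ℂ (φ γ) f‖ ^ 2 := by
    intro f
    have := lp.norm_rpow_eq_tsum (p := 2) (by norm_num) (C₀ f)
    have h2 : ‖C₀ f‖ ^ 2 = ∑' γ, ‖C₀ f γ‖ ^ 2 := by simpa using this
    exact h2
  have hbd : ∀ f, ‖C₀ f‖ ≤ √B * ‖f‖ := by
    intro f
    refine (sq_le_sq₀ (norm_nonneg _) (by positivity)).1 ?_
    rw [hC₀, mul_pow, Real.sq_sqrt hB]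
    simp only [hproj _ f]
    refine (hle _ (V.starProjection_apply_mem f)).trans ?_
    have := V.norm_starProjection_apply_le f
    gcongr
  refine ⟨C₀.mkContinuous (√B) hbd, fun f γ => rfl,
    LinearMap.mkContinuous_norm_le _ (Real.sqrt_nonneg _) _, hC₀⟩

theorem hasSum_adjoint_of_analysis {Γ : Type*} {φ : Γ → H}
    {C : H →L[ℂ] lp (fun _ : Γ => ℂ) 2} (hC : ∀ f γ, C f γ = inner ℂ (φ γ) f)
    (c : lp (fun _ : Γ => ℂ) 2) :
    HasSum (fun γ => c γ • φ γ) (ContinuousLinearMap.adjoint C c) := by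
  classical
  have h1 := (lp.hasSum_single (p := 2) (by norm_num) c).mapL (ContinuousLinearMap.adjoint C)
  convert! h1 using 2 with γ
  refine ext_inner_right ℂ fun x => ?_
  rw [ContinuousLinearMap.adjoint_inner_left, lp.inner_single_left, hC, inner_smul_left]
  simp [mul_comm]

/-- The coefficients are `⟨φ_γ, g⟩` with `S g = f`. Summing over blocks bounds them by `∑ θ` times
the local norm of `g`, which `exists_localNorm_solution` controls by that of `f`. -/
theorem exists_bounded_frame_coefficients {d : ℕ} {P : (Fin d → ℤ) → H →L[ℂ] H}
    (hP : BlockDecomposition P) {X : Set (Rd d)} {N : ℕ} (hX : CubeCardLE X N)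
    {θ : (Fin d → ℤ) → ℝ} (hθ0 : ∀ m, 0 ≤ θ m) (hθ : Summable θ) {φ : X → H}
    (hφ : ∀ k γ, ‖P k (φ γ)‖ ≤ θ (k - cubeIndex (γ : Rd d))) {V : Submodule ℂ H}
    (hV : IsClosed (V : Set H)) (hφV : ∀ γ, φ γ ∈ V)
    (hframe : ∃ A B : ℝ, 0 < A ∧ ∀ f ∈ V, Summable (fun γ => ‖inner ℂ (φ γ) f‖ ^ 2) ∧
      A * ‖f‖ ^ 2 ≤ ∑' γ, ‖inner ℂ (φ γ) f‖ ^ 2 ∧ ∑' γ, ‖inner ℂ (φ γ) f‖ ^ 2 ≤ B * ‖f‖ ^ 2) :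
    ∃ M : ℝ, 0 ≤ M ∧ ∀ f ∈ V, ∀ D : ℝ, (∀ k, ‖P k f‖ ≤ D) →
      ∃ c : X → ℂ, (∀ γ, ‖c γ‖ ≤ M * D) ∧ HasSum (fun γ => c γ • φ γ) f := by
  obtain ⟨A, B₀, hA, hfr⟩ := hframe
  -- If `V = 0`, the given upper bound may fail to be positive; the maximum also ensures `A ≤ B`.
  set B := max A B₀ with hBdef
  have hB : 0 < B := hA.trans_le (le_max_left _ _)
  obtain ⟨C, hC, hCnorm, hCsq⟩ := exists_analysis_operator hV hφV hB.le (fun f hf => (hfr f hf).1)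
    fun f hf => (hfr f hf).2.2.trans (mul_le_mul_of_nonneg_right (le_max_right _ _) (by positivity))
  set S : H →L[ℂ] H := ContinuousLinearMap.adjoint C ∘L C with hSdef
  have hS : ∀ f, HasSum (fun γ => (inner ℂ (φ γ) f : ℂ) • φ γ) (S f) := by
    intro f
    have := hasSum_adjoint_of_analysis hC (C f)
    simp only [hC] at this
    exact this
  have hSinner : ∀ f, RCLike.re (inner ℂ (S f) f) = ‖C f‖ ^ 2 := by
    intro f
    rw [hSdef, ContinuousLinearMap.comp_apply, ContinuousLinearMap.adjoint_inner_left,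
      inner_self_eq_norm_sq]
  obtain ⟨r, Q, hQ0, hQ⟩ := hP.exists_localNorm_solution (S := S) (A := A) (B := B)
    (isBlockDominated_frameOperator hP hX hθ0 hθ hφ hS) hV
    (fun f => hV.mem_of_tendsto (hS f) (Eventually.of_forall fun s =>
      V.sum_mem fun γ _ => V.smul_mem _ (hφV γ)))
    (fun f hf => by
      refine (hS f).unique ?_
      convert! hasSum_zero using 2 with γ
      rw [V.inner_right_of_mem_orthogonal (hφV γ) hf, zero_smul])
    hA (le_max_left _ _) (fun f hf => by rw [hSinner, hCsq]; exact (hfr f hf).2.1)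
    (fun f => by
      rw [hSinner, hSdef, ContinuousLinearMap.comp_apply]
      have h1 : ‖ContinuousLinearMap.adjoint C (C f)‖ ≤ √B * ‖C f‖ :=
        (ContinuousLinearMap.le_opNorm _ _).trans (mul_le_mul_of_nonneg_right
          (by rwa [LinearIsometryEquiv.norm_map]) (norm_nonneg _))
      calc _ ≤ (√B * ‖C f‖) ^ 2 := by gcongr
        _ = _ := by rw [mul_pow, Real.sq_sqrt hB.le])
  refine ⟨(∑' m, θ m) * (Q * ((2 * r + 1) ^ d : ℕ)), mul_nonneg (tsum_nonneg hθ0) (by positivity),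
    fun f hf D hD => ?_⟩
  obtain ⟨g, -, hgf, hgN⟩ := hQ f hf
  refine ⟨fun γ => inner ℂ (φ γ) g, fun γ => ?_, by rw [← hgf]; exact hS g⟩
  -- The cube size `r` is already fixed, so the crude triangle inequality over its `(2r+1)^d` blocks
  -- suffices.
  have hfN : BlockDecomposition.localNorm P r f ≤ ((2 * r + 1) ^ d : ℕ) * D := by
    refine ciSup_le fun k => (norm_sum_le_of_le _ fun l _ => hD l).trans ?_
    have hcard : (BlockDecomposition.latticeCube k r).card = (2 * r + 1) ^ d := by
      rw [BlockDecomposition.latticeCube, Pi.card_Icc]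
      have : ∀ i, (Finset.Icc (k i - r) (k i + r)).card = 2 * r + 1 := by
        intro i
        rw [Int.card_Icc]
        omega
      simp [this]
    rw [Finset.sum_const, nsmul_eq_mul, hcard]
  have h1 : HasSum (fun k => (inner ℂ (P k (φ γ)) (P k g) : ℂ)) (inner ℂ (φ γ) g) := by
    have := (hP.hasSum g).mapL (innerSL ℂ (φ γ))
    simp only [innerSL_apply_apply] at this
    convert! this using 2 with k
    rw [hP.inner_left, hP.idem]
  have h2 : HasSum (fun k => θ (k - cubeIndex (γ : Rd d))) (∑' m, θ m) :=
    ((Equiv.subRight (cubeIndex (γ : Rd d))).hasSum_iff (f := θ)).2 hθ.hasSum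
  dsimp only
  rw [← h1.tsum_eq]
  refine (tsum_of_norm_bounded (h2.mul_right (BlockDecomposition.localNorm P r g)) fun k => ?_).trans ?_
  · exact (norm_inner_le_norm _ _).trans (mul_le_mul (hφ k γ) (hP.norm_apply_le_localNorm k r g)
      (norm_nonneg _) (hθ0 _))
  · rw [mul_assoc, mul_assoc]
    refine mul_le_mul_of_nonneg_left (hgN.trans ?_) (tsum_nonneg hθ0)
    exact mul_le_mul_of_nonneg_left hfN hQ0

end Frame

/-! ### The decomposition of `L²(ℝ^d)` into cubes -/

theorem iUnion_cube (d : ℕ) : (⋃ k : Fin d → ℤ, cubeIndex (d := d) ⁻¹' {k}) = Set.univ :=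
  Set.eq_univ_of_forall fun x => Set.mem_iUnion.2 ⟨cubeIndex x, rfl⟩

theorem measurableSet_cube {d : ℕ} (k : Fin d → ℤ) :
    MeasurableSet (cubeIndex (d := d) ⁻¹' {k}) :=
  measurable_cubeIndex (MeasurableSet.singleton k)

/-- The product of an `L²` function with the indicator function of a unit cube. -/
noncomputable def cubeRestrict {d : ℕ} (k : Fin d → ℤ) (f : L2Rd d) : L2Rd d :=
  ((Lp.memLp f).indicator (measurableSet_cube k)).toLp ((cubeIndex ⁻¹' {k}).indicator f)

theorem norm_cubeRestrict {d : ℕ} (k : Fin d → ℤ) (f : L2Rd d) :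
    ‖cubeRestrict k f‖ = (eLpNorm ((cubeIndex ⁻¹' {k}).indicator f) 2 volume).toReal :=
  Lp.norm_toLp _ _

/-- Multiplication by the indicator function of a unit cube, as an operator. -/
noncomputable def cubeProj {d : ℕ} (k : Fin d → ℤ) : L2Rd d →L[ℂ] L2Rd d :=
  LinearMap.mkContinuous
    { toFun := cubeRestrict k
      map_add' := fun f g => by
        rw [cubeRestrict, cubeRestrict, cubeRestrict, ← MemLp.toLp_add, MemLp.toLp_eq_toLp_iff]
        filter_upwards [Lp.coeFn_add f g] with x hx
        simp only [Pi.add_apply, Set.indicator]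
        split_ifs
        · rw [hx, Pi.add_apply]
        · rw [add_zero]
      map_smul' := fun c f => by
        rw [cubeRestrict, cubeRestrict, RingHom.id_apply, ← MemLp.toLp_const_smul,
          MemLp.toLp_eq_toLp_iff]
        filter_upwards [Lp.coeFn_smul c f] with x hx
        simp only [Pi.smul_apply, Set.indicator]
        split_ifs
        · rw [hx, Pi.smul_apply]
        · rw [smul_zero] } 1 (fun f => by
    rw [one_mul]
    change ‖cubeRestrict k f‖ ≤ ‖f‖
    rw [norm_cubeRestrict, Lp.norm_def]
    exact ENNReal.toReal_mono (Lp.eLpNorm_ne_top f) (eLpNorm_indicator_le _))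

theorem cubeProj_apply {d : ℕ} (k : Fin d → ℤ) (f : L2Rd d) :
    cubeProj k f = cubeRestrict k f := rfl

theorem coeFn_cubeProj {d : ℕ} (k : Fin d → ℤ) (f : L2Rd d) :
    cubeProj k f =ᵐ[volume] (cubeIndex ⁻¹' {k}).indicator f := by
  rw [cubeProj_apply]
  exact MemLp.coeFn_toLp (f := (cubeIndex ⁻¹' {k}).indicator f) _

theorem inner_cubeProj_left {d : ℕ} (k : Fin d → ℤ) (f g : L2Rd d) :
    inner ℂ (cubeProj k f) g = ∫ x in cubeIndex ⁻¹' {k}, inner ℂ (f x) (g x) := by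
  rw [L2.inner_def, ← integral_indicator (measurableSet_cube k)]
  refine integral_congr_ae ?_
  filter_upwards [coeFn_cubeProj k f] with x hx
  rw [hx]
  simp only [Set.indicator]
  split_ifs
  · rfl
  · rw [inner_zero_left]

/-- The blocks sum to the identity because the squared error of a partial sum is `‖f‖² - ∑ ⟨P_k f,
f⟩`, which tends to zero by countable additivity of the integral. -/
theorem blockDecomposition_cubeProj (d : ℕ) : BlockDecomposition (cubeProj (d := d)) := by
  have hinner : ∀ (k : Fin d → ℤ) (f g : L2Rd d),
      inner ℂ (cubeProj k f) g = inner ℂ f (cubeProj k g) := by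
    intro k f g
    rw [inner_cubeProj_left, ← inner_conj_symm, inner_cubeProj_left, ← integral_conj]
    exact integral_congr_ae (Eventually.of_forall fun x => (inner_conj_symm _ _).symm)
  have hcomp : ∀ (k l : Fin d → ℤ) (f : L2Rd d),
      cubeProj k (cubeProj l f) = if k = l then cubeProj l f else 0 := by
    intro k l f
    refine Lp.ext ?_
    split_ifs with h
    · subst h
      filter_upwards [coeFn_cubeProj k (cubeProj k f), coeFn_cubeProj k f] with x h1 h2
      rw [h1]
      simp only [Set.indicator] at h2 ⊢
      split_ifs with h3
      · rfl
      · rw [h2, if_neg h3]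
    · filter_upwards [coeFn_cubeProj k (cubeProj l f), coeFn_cubeProj l f,
        Lp.coeFn_zero ℂ 2 (volume : Measure (Rd d))] with x h1 h2 h4
      rw [h1, h4, Pi.zero_apply]
      simp only [Set.indicator] at h2 ⊢
      split_ifs with h3
      · rw [h2, if_neg]
        rintro rfl
        exact h h3.symm
      · rfl
  refine ⟨hinner, hcomp, fun f => ?_⟩
  have h1 : HasSum (fun k => (inner ℂ (cubeProj k f) f : ℂ)) (inner ℂ f f) := by
    simp only [inner_cubeProj_left]
    have hint : Integrable (fun x => (inner ℂ (f x) (f x) : ℂ)) volume := L2.integrable_inner f f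
    have := hasSum_integral_iUnion (s := fun k : Fin d → ℤ => cubeIndex (d := d) ⁻¹' {k})
      (f := fun x => (inner ℂ (f x) (f x) : ℂ)) measurableSet_cube
      (fun k l hkl => Set.disjoint_left.2 fun x hx hx' => hkl (hx.symm.trans hx'))
      hint.integrableOn
    rwa [iUnion_cube, setIntegral_univ, ← L2.inner_def] at this
  have h2 : ∀ A : Finset (Fin d → ℤ), ‖∑ k ∈ A, cubeProj k f - f‖ ^ 2 =
      RCLike.re (inner ℂ f f - ∑ k ∈ A, inner ℂ (cubeProj k f) f : ℂ) := by
    intro A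
    set y := ∑ k ∈ A, cubeProj k f with hy
    have h3 : (inner ℂ y y : ℂ) = inner ℂ y f := by
      nth_rewrite 1 [hy]
      nth_rewrite 2 [hy]
      rw [sum_inner, sum_inner]
      refine Finset.sum_congr rfl fun k hk => ?_
      rw [hinner, hinner, hy, map_sum, Finset.sum_congr rfl fun l _ => hcomp k l f,
        Finset.sum_ite_eq, if_pos hk]
    have h4 : (inner ℂ f y : ℂ) = inner ℂ y f := by
      rw [hy, sum_inner, inner_sum]
      exact Finset.sum_congr rfl fun k _ => (hinner k f f).symm
    rw [← inner_self_eq_norm_sq (𝕜 := ℂ), inner_sub_left, inner_sub_right, inner_sub_right, h3, h4,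
      sub_self, zero_sub, neg_sub, hy, sum_inner]
  have h3 : Tendsto (fun A : Finset (Fin d → ℤ) => ‖∑ k ∈ A, cubeProj k f - f‖ ^ 2) atTop
      (𝓝 0) := by
    simp only [h2]
    have h4 : Tendsto (fun A : Finset (Fin d → ℤ) =>
        (inner ℂ f f - ∑ k ∈ A, inner ℂ (cubeProj k f) f : ℂ)) atTop (𝓝 0) := by
      have := (tendsto_const_nhds (x := (inner ℂ f f : ℂ))).sub h1
      rwa [sub_self] at this
    have h5 := (RCLike.continuous_re (K := ℂ)).tendsto 0 |>.comp h4
    rwa [map_zero] at h5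
  rw [HasSum, SummationFilter.unconditional_filter, tendsto_iff_norm_sub_tendsto_zero]
  have h4 := h3.sqrt
  simpa using h4

theorem volume_cube_le {d : ℕ} (k : Fin d → ℤ) :
    volume (cubeIndex (d := d) ⁻¹' {k}) ≤ volume (Metric.ball (0 : Rd d) (d + 2)) := by
  have h1 : cubeIndex (d := d) ⁻¹' {k} ⊆ Metric.ball (latticePoint k) (d + 2) := by
    rintro x rfl
    have := norm_sub_latticePoint_le x
    rw [Metric.mem_ball, dist_eq_norm]
    linarith
  refine (measure_mono h1).trans_eq ?_
  rw [Measure.addHaar_ball_center]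

theorem memLp_one_of_envelope {d : ℕ} {ω : (Fin d → ℤ) → ℝ} (h0 : ∀ k, 0 ≤ ω k)
    (hω : Summable ω) {f : Rd d → ℂ} (hfc : Continuous f) (hf : ∀ x, ‖f x‖ ≤ ω (cubeIndex x)) :
    MemLp f 1 volume := by
  refine ⟨hfc.aestronglyMeasurable, ?_⟩
  rw [eLpNorm_one_eq_lintegral_enorm, ← setLIntegral_univ, ← iUnion_cube d]
  refine (lintegral_iUnion_le _ _).trans_lt ?_
  have h1 : ∀ k, ∫⁻ x in cubeIndex (d := d) ⁻¹' {k}, ‖f x‖ₑ ≤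
      ENNReal.ofReal (ω k) * volume (Metric.ball (0 : Rd d) (d + 2)) := by
    intro k
    calc ∫⁻ x in cubeIndex (d := d) ⁻¹' {k}, ‖f x‖ₑ
        ≤ ∫⁻ _x in cubeIndex (d := d) ⁻¹' {k}, ENNReal.ofReal (ω k) := by
          refine setLIntegral_mono' (measurableSet_cube k) fun x hx => ?_
          rw [← ofReal_norm]
          refine ENNReal.ofReal_le_ofReal ((hf x).trans_eq ?_)
          rw [show cubeIndex x = k from hx]
      _ ≤ _ := by
          rw [setLIntegral_const]
          exact mul_le_mul_right (volume_cube_le k) _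
  refine (ENNReal.tsum_le_tsum h1).trans_lt ?_
  rw [ENNReal.tsum_mul_right, ← ENNReal.ofReal_tsum_of_nonneg h0 hω]
  exact ENNReal.mul_lt_top ENNReal.ofReal_lt_top measure_ball_lt_top

theorem exists_norm_cubeProj_le (d : ℕ) :
    ∃ κ : ℝ, 0 ≤ κ ∧ ∀ (k : Fin d → ℤ) (f : L2Rd d) (D : ℝ),
      (∀ᵐ x ∂(volume : Measure (Rd d)), cubeIndex x = k → ‖f x‖ ≤ D) →
        ‖cubeProj k f‖ ≤ κ * D := by
  set v : ℝ≥0∞ := volume (Metric.ball (0 : Rd d) (d + 2)) with hv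
  have hvt : v < ∞ := measure_ball_lt_top
  refine ⟨(v ^ (1 / 2 : ℝ)).toReal, ENNReal.toReal_nonneg, fun k f D h => ?_⟩
  have hQ : volume (cubeIndex (d := d) ⁻¹' {k}) ≤ v := volume_cube_le k
  have hQ0 : 0 < volume (cubeIndex (d := d) ⁻¹' {k}) := by
    have hopen : IsOpen {x : Rd d | ∀ i, (k i : ℝ) < x i ∧ x i < k i + 1} := by
      simp only [Set.ofPred_forall]
      refine isOpen_iInter_of_finite fun i => ?_
      have h1 : Continuous fun x : Rd d => x i := by fun_prop
      exact (isOpen_lt continuous_const h1).inter (isOpen_lt h1 continuous_const)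
    refine (hopen.measure_pos volume
      ⟨WithLp.toLp 2 fun i => (k i : ℝ) + 1 / 2, fun i => ?_⟩).trans_le (measure_mono ?_)
    · constructor <;> simp
      norm_num
    · intro x hx
      refine funext fun i => Int.floor_eq_iff.2 ⟨(hx i).1.le, (hx i).2⟩
  have hae : ∀ᵐ x ∂volume.restrict (cubeIndex (d := d) ⁻¹' {k}), ‖f x‖ ≤ D :=
    (ae_restrict_iff' (measurableSet_cube k)).2 h
  -- The cube has positive measure, so `D` bounds a norm at some actual point.
  have hD : 0 ≤ D := by
    have : (ae (volume.restrict (cubeIndex (d := d) ⁻¹' {k}))).NeBot := by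
      rw [ae_neBot, Ne, Measure.restrict_eq_zero]
      exact hQ0.ne'
    obtain ⟨x, hx⟩ := hae.exists
    exact (norm_nonneg _).trans hx
  rw [cubeProj_apply, norm_cubeRestrict, eLpNorm_indicator_eq_eLpNorm_restrict (measurableSet_cube k)]
  have h1 := eLpNorm_le_of_ae_bound (p := 2) hae
  rw [Measure.restrict_apply_univ] at h1
  have h2 : eLpNorm f 2 (volume.restrict (cubeIndex (d := d) ⁻¹' {k})) ≤
      v ^ (1 / 2 : ℝ) * ENNReal.ofReal D := by
    refine h1.trans ?_
    gcongr ?_ * _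
    simpa using ENNReal.rpow_le_rpow hQ (by norm_num : (0 : ℝ) ≤ 1 / 2)
  have h3 := ENNReal.toReal_mono (ENNReal.mul_ne_top
    (ENNReal.rpow_ne_top_of_nonneg (by norm_num) hvt.ne) ENNReal.ofReal_ne_top) h2
  rwa [ENNReal.toReal_mul, ENNReal.toReal_ofReal hD] at h3

/-! ### Series with respect to a localized family of functions -/

/-- Continuous functions `F γ`, indexed by a set with at most `N` points in every unit cube, that
are dominated on cubes by translates of a summable envelope. -/
structure IsLocalizedFamily {d : ℕ} (X : Set (Rd d)) (N : ℕ) (θ : (Fin d → ℤ) → ℝ)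
    (F : X → Rd d → ℂ) : Prop where
  card : CubeCardLE X N
  nonneg : ∀ m, 0 ≤ θ m
  summable : Summable θ
  continuous : ∀ γ, Continuous (F γ)
  norm_le : ∀ γ x, ‖F γ x‖ ≤ θ (cubeIndex x - cubeIndex (γ : Rd d))

theorem LocalizedFrame.exists_isLocalizedFamily {d : ℕ} {V : Submodule ℂ (L2Rd d)}
    (𝓕 : LocalizedFrame V) : ∃ N θ, IsLocalizedFamily 𝓕.Γ N θ 𝓕.F := by
  obtain ⟨N₀, hN₀⟩ := 𝓕.relSeparated
  obtain ⟨N, hN⟩ := CubeCardLE.of_ball (d := d) one_pos N₀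
  obtain ⟨θ, h0, hs, hle⟩ := exists_cube_envelope 𝓕.memAmalgam
  exact ⟨N, θ, hN _ hN₀, h0, hs, 𝓕.continuous_F,
    fun γ x => hle _ _ (𝓕.continuous_F γ) (𝓕.localized γ) x⟩

namespace IsLocalizedFamily

variable {d : ℕ} {X : Set (Rd d)} {N : ℕ} {θ : (Fin d → ℤ) → ℝ} {F : X → Rd d → ℂ}

theorem summable_envelope (h : IsLocalizedFamily X N θ F) (k : Fin d → ℤ) :
    Summable fun γ : X => θ (k - cubeIndex (γ : Rd d)) :=
  h.card.summable (fun _ => h.nonneg _) (((Equiv.subLeft k).summable_iff (f := θ)).2 h.summable)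

theorem tsum_envelope_le (h : IsLocalizedFamily X N θ F) (k : Fin d → ℤ) :
    ∑' γ : X, θ (k - cubeIndex (γ : Rd d)) ≤ N * ∑' m, θ m := by
  have h1 := h.card.tsum_le (φ := fun j => θ (k - j)) (fun _ => h.nonneg _)
    (((Equiv.subLeft k).summable_iff (f := θ)).2 h.summable)
  have h2 : ∑' j, θ (k - j) = ∑' m, θ m := (Equiv.subLeft k).tsum_eq θ
  rwa [h2] at h1

theorem norm_mul_le (h : IsLocalizedFamily X N θ F) {c : X → ℂ} {M : ℝ}
    (hc : ∀ γ, ‖c γ‖ ≤ M) (γ : X) (x : Rd d) :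
    ‖c γ * F γ x‖ ≤ M * θ (cubeIndex x - cubeIndex (γ : Rd d)) := by
  rw [norm_mul]
  exact mul_le_mul (hc γ) (h.norm_le γ x) (norm_nonneg _) ((norm_nonneg _).trans (hc γ))

theorem summable_norm_mul (h : IsLocalizedFamily X N θ F) {c : X → ℂ} {M : ℝ}
    (hc : ∀ γ, ‖c γ‖ ≤ M) (x : Rd d) : Summable fun γ => ‖c γ * F γ x‖ :=
  ((h.summable_envelope (cubeIndex x)).mul_left M).of_nonneg_of_le (fun _ => norm_nonneg _)
    fun γ => h.norm_mul_le hc γ x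

theorem hasSum_mul (h : IsLocalizedFamily X N θ F) {c : X → ℂ} {M : ℝ}
    (hc : ∀ γ, ‖c γ‖ ≤ M) (x : Rd d) :
    HasSum (fun γ => c γ * F γ x) (∑' γ, c γ * F γ x) :=
  (h.summable_norm_mul hc x).of_norm.hasSum

theorem norm_le_of_hasSum (h : IsLocalizedFamily X N θ F) {c : X → ℂ} {M : ℝ} (hM : 0 ≤ M)
    (hc : ∀ γ, ‖c γ‖ ≤ M) {x : Rd d} {y : ℂ} (hy : HasSum (fun γ => c γ * F γ x) y) :
    ‖y‖ ≤ M * (N * ∑' m, θ m) := by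
  rw [← hy.tsum_eq]
  exact (tsum_of_norm_bounded ((h.summable_envelope (cubeIndex x)).hasSum.mul_left M) fun γ =>
    h.norm_mul_le hc γ x).trans (mul_le_mul_of_nonneg_left (h.tsum_envelope_le _) hM)

theorem cubeIndex_sub_mem {x y : Rd d} (hxy : dist x y < 1) :
    cubeIndex x - cubeIndex y ∈ Finset.Icc (fun _ : Fin d => (-1 : ℤ)) (fun _ => 1) := by
  rw [Finset.mem_Icc]
  have h : ∀ i, |x i - y i| < 1 := fun i => by
    have := PiLp.norm_apply_le (x - y) i
    rw [dist_eq_norm] at hxy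
    exact this.trans_lt hxy
  refine ⟨fun i => ?_, fun i => ?_⟩
  · have h1 := (abs_lt.1 (h i)).1
    have h2 := Int.lt_floor_add_one (x i)
    have h3 := Int.floor_le (y i)
    have h4 : (⌊y i⌋ : ℝ) < ((⌊x i⌋ + 2 : ℤ) : ℝ) := by push_cast; linarith
    have h5 : ⌊y i⌋ < ⌊x i⌋ + 2 := by exact_mod_cast h4
    simp only [cubeIndex, Pi.sub_apply]
    omega
  · have h1 := (abs_lt.1 (h i)).2
    have h2 := Int.lt_floor_add_one (y i)
    have h3 := Int.floor_le (x i)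
    have h4 : (⌊x i⌋ : ℝ) < ((⌊y i⌋ + 2 : ℤ) : ℝ) := by push_cast; linarith
    have h5 : ⌊x i⌋ < ⌊y i⌋ + 2 := by exact_mod_cast h4
    simp only [cubeIndex, Pi.sub_apply]
    omega

/-- Locally uniform convergence: within distance one of `x₀` the cube index moves by at most one in
each coordinate, so the sum of finitely many shifted envelopes dominates all terms. -/
theorem continuous_tsum_of_le (h : IsLocalizedFamily X N θ F) {E : Type*} [NormedAddCommGroup E]
    [CompleteSpace E] {G : X → Rd d → E} (hG : ∀ γ, Continuous (G γ)) {M : ℝ} (hM : 0 ≤ M)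
    (hle : ∀ γ x, ‖G γ x‖ ≤ M * θ (cubeIndex x - cubeIndex (γ : Rd d))) :
    Continuous fun x => ∑' γ, G γ x := by
  rw [continuous_iff_continuousAt]
  intro x₀
  set T := Finset.Icc (fun _ : Fin d => (-1 : ℤ)) (fun _ => 1)
  have h1 : Summable fun γ : X => ∑ t ∈ T, M * θ (cubeIndex x₀ + t - cubeIndex (γ : Rd d)) :=
    summable_sum fun t _ => (h.summable_envelope (cubeIndex x₀ + t)).mul_left M
  refine (continuousOn_tsum (s := Metric.ball x₀ 1) (fun γ => (hG γ).continuousOn) h1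
    fun γ x hx => (hle γ x).trans ?_).continuousAt (Metric.ball_mem_nhds _ one_pos)
  have h2 : cubeIndex x = cubeIndex x₀ + (cubeIndex x - cubeIndex x₀) := by abel
  nth_rewrite 1 [h2]
  exact Finset.single_le_sum (f := fun t => M * θ (cubeIndex x₀ + t - cubeIndex (γ : Rd d)))
    (fun t _ => mul_nonneg hM (h.nonneg _)) (cubeIndex_sub_mem hx)

theorem continuous_of_hasSum (h : IsLocalizedFamily X N θ F) {c : X → ℂ} {M : ℝ} (hM : 0 ≤ M)
    (hc : ∀ γ, ‖c γ‖ ≤ M) {f : Rd d → ℂ} (hf : ∀ x, HasSum (fun γ => c γ * F γ x) (f x)) :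
    Continuous f := by
  have : f = fun x => ∑' γ, c γ * F γ x := funext fun x => (hf x).tsum_eq.symm
  rw [this]
  exact h.continuous_tsum_of_le (fun γ => continuous_const.mul (h.continuous γ)) hM
    fun γ x => h.norm_mul_le hc γ x

theorem tendsto_tsum_mul (h : IsLocalizedFamily X N θ F) {α : Type*} {l : Filter α}
    {c : α → X → ℂ} {c' : X → ℂ} {M : ℝ} (hc : ∀ a γ, ‖c a γ‖ ≤ M)
    (hlim : ∀ γ, Tendsto (fun a => c a γ) l (𝓝 (c' γ))) (x : Rd d) :
    Tendsto (fun a => ∑' γ, c a γ * F γ x) l (𝓝 (∑' γ, c' γ * F γ x)) :=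
  tendsto_tsum_of_dominated_convergence ((h.summable_envelope (cubeIndex x)).mul_left M)
    (fun γ => (hlim γ).mul_const _) (Eventually.of_forall fun a γ => h.norm_mul_le (hc a) γ x)

/-- Convergence of the series in `L^p` to a continuous function implies pointwise convergence. -/
theorem hasSum_of_tendsto_eLpNorm (h : IsLocalizedFamily X N θ F) {c : X → ℂ} {M : ℝ}
    (hM : 0 ≤ M) (hc : ∀ γ, ‖c γ‖ ≤ M) {f : Rd d → ℂ} (hf : Continuous f) {p : ℝ≥0∞}
    (hp : p ≠ 0) (hlim : Tendsto (fun s : Finset X =>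
      eLpNorm (fun x => f x - ∑ γ ∈ s, c γ * F γ x) p volume) atTop (𝓝 0)) (x : Rd d) :
    HasSum (fun γ => c γ * F γ x) (f x) := by
  -- Countability makes `atTop` on the finite subsets countably generated, as needed to extract an
  -- almost everywhere convergent sequence of partial sums.
  have := h.card.countable
  set g : Rd d → ℂ := fun x => ∑' γ, c γ * F γ x with hg
  have hgs : ∀ x, HasSum (fun γ => c γ * F γ x) (g x) := h.hasSum_mul hc
  have hgc : Continuous g := h.continuous_of_hasSum hM hc hgs
  have hmeas : ∀ s : Finset X, AEStronglyMeasurable (fun x => ∑ γ ∈ s, c γ * F γ x)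
      (volume : Measure (Rd d)) := fun s =>
    (continuous_finsetSum s fun γ _ =>
      continuous_const.mul (h.continuous γ)).aestronglyMeasurable
  have h1 : TendstoInMeasure volume (fun (s : Finset X) x => ∑ γ ∈ s, c γ * F γ x) atTop f := by
    refine tendstoInMeasure_of_tendsto_eLpNorm hp hmeas hf.aestronglyMeasurable ?_
    refine hlim.congr fun s => ?_
    rw [← eLpNorm_neg]
    congr 1
    funext x
    simp
  obtain ⟨ns, hns, hae⟩ := h1.exists_seq_tendsto_ae'
  have h2 : f =ᵐ[volume] g := by
    filter_upwards [hae] with x hx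
    have h4 : Tendsto (fun s : Finset X => ∑ γ ∈ s, c γ * F γ x) atTop (𝓝 (g x)) := hgs x
    exact tendsto_nhds_unique hx (h4.comp hns)
  have h3 : f = g := (hf.ae_eq_iff_eq volume hgc).1 h2
  rw [h3]
  exact hgs x

theorem hasSum_integral_mul (h : IsLocalizedFamily X N θ F) {c : X → ℂ} {M : ℝ} (hM : 0 ≤ M)
    (hc : ∀ γ, ‖c γ‖ ≤ M) {f : Rd d → ℂ} (hf : ∀ x, HasSum (fun γ => c γ * F γ x) (f x))
    {g : Rd d → ℂ} (hg : Integrable g volume) :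
    HasSum (fun γ => ∫ x, (c γ * F γ x) * g x) (∫ x, f x * g x) := by
  have := h.card.countable
  refine hasSum_integral_of_dominated_convergence (fun γ x => ‖c γ * F γ x‖ * ‖g x‖) (fun γ => ?_)
    (fun γ => Eventually.of_forall fun x => (norm_mul _ _).le)
    (Eventually.of_forall fun x => (h.summable_norm_mul hc x).mul_right _) ?_
    (Eventually.of_forall fun x => (hf x).mul_right _)
  · exact (continuous_const.mul (h.continuous γ)).aestronglyMeasurable.mul hg.aestronglyMeasurable
  · simp only [tsum_mul_right]
    have hcont : Continuous fun x => ∑' γ, ‖c γ * F γ x‖ :=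
      h.continuous_tsum_of_le (fun γ => (continuous_const.mul (h.continuous γ)).norm) hM
        fun γ x => by rw [norm_norm]; exact h.norm_mul_le hc γ x
    refine hg.norm.bdd_mul (c := M * (N * ∑' m, θ m)) hcont.aestronglyMeasurable
      (Eventually.of_forall fun x => ?_)
    refine (tsum_of_norm_bounded ((h.summable_envelope (cubeIndex x)).hasSum.mul_left M)
      fun γ => ?_).trans (mul_le_mul_of_nonneg_left (h.tsum_envelope_le _) hM)
    rw [norm_norm]
    exact h.norm_mul_le hc γ x

/-- A series with absolutely summable coefficients has a summable envelope on cubes. -/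
theorem exists_envelope_of_summable (h : IsLocalizedFamily X N θ F) {c : X → ℂ}
    (hc : Summable fun γ => ‖c γ‖) :
    ∃ ω : (Fin d → ℤ) → ℝ, (∀ k, 0 ≤ ω k) ∧ Summable ω ∧
      ∀ (s : Finset X) (x : Rd d), ‖∑ γ ∈ s, c γ * F γ x‖ ≤ ω (cubeIndex x) := by
  have hprod : Summable fun p : (Fin d → ℤ) × X =>
      ‖c p.2‖ * θ (p.1 - cubeIndex (p.2 : Rd d)) := by
    let e : (Fin d → ℤ) × X ≃ X × (Fin d → ℤ) :=
      ⟨fun p => (p.2, p.1 - cubeIndex (p.2 : Rd d)), fun p => (p.2 + cubeIndex (p.1 : Rd d), p.1),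
        fun p => by simp, fun p => by simp⟩
    exact (e.summable_iff (f := fun p : X × (Fin d → ℤ) => ‖c p.1‖ * θ p.2)).2
      (hc.mul_of_nonneg h.summable (fun _ => norm_nonneg _) h.nonneg)
  have h0 : ∀ k (γ : X), 0 ≤ ‖c γ‖ * θ (k - cubeIndex (γ : Rd d)) := fun k γ =>
    mul_nonneg (norm_nonneg _) (h.nonneg _)
  -- Absolute values are summed, so the same envelope dominates every finite partial sum, as
  -- dominated convergence over `Λ` requires later.
  refine ⟨fun k => ∑' γ : X, ‖c γ‖ * θ (k - cubeIndex (γ : Rd d)), fun k => tsum_nonneg (h0 k),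
    hprod.prod, fun s x => ?_⟩
  refine (norm_sum_le_of_le s fun γ _ => ?_).trans
    ((hprod.prod_factor (cubeIndex x)).sum_le_tsum s fun γ _ => h0 _ γ)
  rw [norm_mul]
  exact mul_le_mul_of_nonneg_left (h.norm_le γ x) (norm_nonneg _)

end IsLocalizedFamily

theorem tendsto_zero_of_envelope {d : ℕ} {ω : (Fin d → ℤ) → ℝ} (hω : Summable ω)
    {f : Rd d → ℂ} (hf : ∀ x, ‖f x‖ ≤ ω (cubeIndex x)) : Tendsto f (cocompact (Rd d)) (𝓝 0) :=
  squeeze_zero_norm hf (hω.tendsto_cofinite_zero.comp (tendsto_cubeIndex_cocompact d))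

/-! ### The spaces `V^1` and `V^∞` -/

namespace LocalizedFrame

variable {d : ℕ} {V : Submodule ℂ (L2Rd d)}

/-- The span of finitely many frame elements, as a space of functions. -/
noncomputable def finSpan (𝓕 : LocalizedFrame V) (s : Finset 𝓕.Γ) : Submodule ℂ (Rd d → ℂ) :=
  Submodule.span ℂ (𝓕.F '' s)

theorem exists_sum_of_mem_finSpan (𝓕 : LocalizedFrame V) {s : Finset 𝓕.Γ} {f : Rd d → ℂ}
    (hf : f ∈ 𝓕.finSpan s) :
    ∃ c : 𝓕.Γ → ℂ, (∀ γ ∉ s, c γ = 0) ∧ f = fun x => ∑ γ ∈ s, c γ * 𝓕.F γ x := by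
  classical
  obtain ⟨c, hc⟩ := Submodule.mem_span_image_finset_iff_exists_fun ℂ |>.1 hf
  refine ⟨fun γ => if h : γ ∈ s then c ⟨γ, h⟩ else 0, fun γ hγ => dif_neg hγ, ?_⟩
  rw [← hc]
  funext x
  rw [Finset.sum_apply, ← Finset.sum_attach s]
  refine Finset.sum_congr rfl fun γ _ => ?_
  dsimp only
  rw [dif_pos γ.2, Pi.smul_apply, smul_eq_mul]

theorem sum_mem_finSpan (𝓕 : LocalizedFrame V) (s : Finset 𝓕.Γ) (c : 𝓕.Γ → ℂ) :
    (fun x => ∑ γ ∈ s, c γ * 𝓕.F γ x) ∈ 𝓕.finSpan s := by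
  have : (fun x => ∑ γ ∈ s, c γ * 𝓕.F γ x) = ∑ γ ∈ s, c γ • 𝓕.F γ := by
    funext x
    simp
  rw [this]
  exact Submodule.sum_mem _ fun γ hγ => Submodule.smul_mem _ _
    (Submodule.subset_span ⟨γ, hγ, rfl⟩)

theorem finSpan_mono (𝓕 : LocalizedFrame V) {s t : Finset 𝓕.Γ} (h : s ⊆ t) :
    𝓕.finSpan s ≤ 𝓕.finSpan t :=
  Submodule.span_mono (Set.image_mono h)

instance (𝓕 : LocalizedFrame V) (s : Finset 𝓕.Γ) : FiniteDimensional ℂ (𝓕.finSpan s) :=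
  FiniteDimensional.span_of_finite ℂ (s.finite_toSet.image _)

/-- Pointwise convergence with bounded coefficients implies weak-star convergence by dominated
convergence. Membership in `V^∞` is obtained only in this way. -/
theorem mem_space_top_of_hasSum (𝓕 : LocalizedFrame V) {N : ℕ} {θ : (Fin d → ℤ) → ℝ}
    (h : IsLocalizedFamily 𝓕.Γ N θ 𝓕.F) {c : 𝓕.Γ → ℂ} {M : ℝ} (hM : 0 ≤ M)
    (hc : ∀ γ, ‖c γ‖ ≤ M) {f : Rd d → ℂ} (hf : ∀ x, HasSum (fun γ => c γ * 𝓕.F γ x) (f x)) :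
    f ∈ 𝓕.space ∞ := by
  have hcont := h.continuous_of_hasSum hM hc hf
  refine ⟨hcont, memLp_top_of_bound hcont.aestronglyMeasurable _
    (Eventually.of_forall fun x => h.norm_le_of_hasSum hM hc (hf x)), c,
    memℓp_infty ⟨M, by rintro _ ⟨γ, rfl⟩; exact hc γ⟩, fun h => absurd rfl h,
    fun _ g hg => h.hasSum_integral_mul hM hc hf hg⟩

theorem exists_coeff_of_mem_space_one (𝓕 : LocalizedFrame V) {N : ℕ} {θ : (Fin d → ℤ) → ℝ}
    (h : IsLocalizedFamily 𝓕.Γ N θ 𝓕.F) {f : Rd d → ℂ} (hf : f ∈ 𝓕.space 1) :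
    ∃ c : 𝓕.Γ → ℂ, (Summable fun γ => ‖c γ‖) ∧ (∀ x, HasSum (fun γ => c γ * 𝓕.F γ x) (f x)) ∧
      Tendsto (fun s : Finset 𝓕.Γ => eLpNorm (fun x => f x - ∑ γ ∈ s, c γ * 𝓕.F γ x) 1 volume)
        atTop (𝓝 0) := by
  obtain ⟨hcont, -, c, hc, hs⟩ := hf
  have hc1 : Summable fun γ => ‖c γ‖ := by
    have := hc.summable (by norm_num)
    simpa using this
  refine ⟨c, hc1, ?_, hs.1 (by norm_num)⟩
  exact h.hasSum_of_tendsto_eLpNorm (M := ∑' γ, ‖c γ‖) (tsum_nonneg fun _ => norm_nonneg _)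
    (fun γ => hc1.le_tsum γ fun _ _ => norm_nonneg _) hcont one_ne_zero (hs.1 (by norm_num))

theorem memLp_one_F (𝓕 : LocalizedFrame V) (γ : 𝓕.Γ) : MemLp (𝓕.F γ) 1 volume := by
  obtain ⟨N, θ, h⟩ := 𝓕.exists_isLocalizedFamily
  exact memLp_one_of_envelope (ω := fun k => θ (k - cubeIndex (γ : Rd d))) (fun _ => h.nonneg _)
    (((Equiv.subRight (cubeIndex (γ : Rd d))).summable_iff (f := θ)).2 h.summable)
    (h.continuous γ) (h.norm_le γ)

theorem finSpan_subset_space_one (𝓕 : LocalizedFrame V) (s : Finset 𝓕.Γ) :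
    (𝓕.finSpan s : Set (Rd d → ℂ)) ⊆ 𝓕.space 1 := by
  intro f hf
  obtain ⟨c, hc, rfl⟩ := 𝓕.exists_sum_of_mem_finSpan hf
  refine ⟨continuous_finsetSum s fun γ _ => continuous_const.mul (𝓕.continuous_F γ),
    memLp_finsetSum s fun γ _ => (𝓕.memLp_one_F γ).const_mul _, c, ?_, fun _ => ?_,
    fun h => absurd h (by norm_num)⟩
  · refine memℓp_gen ?_
    refine summable_of_ne_finset_zero (s := s) fun γ hγ => ?_
    simp [hc γ hγ]
  · refine tendsto_const_nhds.congr' ?_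
    filter_upwards [eventually_ge_atTop s] with t ht
    have : (fun x => ∑ γ ∈ s, c γ * 𝓕.F γ x - ∑ γ ∈ t, c γ * 𝓕.F γ x) = 0 := by
      funext x
      rw [Finset.sum_subset ht fun γ _ hγ => by rw [hc γ hγ, zero_mul], sub_self, Pi.zero_apply]
    rw [this, eLpNorm_zero]

end LocalizedFrame

/-! ### Uniform coefficient bounds on spans of frame elements -/

namespace LocalizedFrame

variable {d : ℕ} {V : Submodule ℂ (L2Rd d)}

/-- A frame element, as an element of `L²`. -/
noncomputable def toL2 (𝓕 : LocalizedFrame V) (γ : 𝓕.Γ) : L2Rd d := (𝓕.memLp_F γ).toLp (𝓕.F γ)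

theorem exists_toLp_sum (𝓕 : LocalizedFrame V) (c : 𝓕.Γ → ℂ) (s : Finset 𝓕.Γ) :
    ∃ h : MemLp (fun x => ∑ γ ∈ s, c γ * 𝓕.F γ x) 2 volume,
      h.toLp _ = ∑ γ ∈ s, c γ • 𝓕.toL2 γ := by
  classical
  induction s using Finset.induction_on with
  | empty =>
    simp only [Finset.sum_empty]
    exact ⟨MemLp.zero', MemLp.toLp_zero _⟩
  | insert a s ha ih =>
    obtain ⟨h, hs⟩ := ih
    simp only [Finset.sum_insert ha]
    refine ⟨((𝓕.memLp_F a).const_smul (c a)).add h, ?_⟩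
    rw [← hs, toL2, ← MemLp.toLp_const_smul, ← MemLp.toLp_add]
    rfl

/-- Functions in the linear span of a localized frame that are bounded by one have uniformly
bounded coefficients. -/
theorem exists_uniform_coeff_bound (𝓕 : LocalizedFrame V) (hV : IsClosed (V : Set (L2Rd d)))
    {N : ℕ} {θ : (Fin d → ℤ) → ℝ} (h : IsLocalizedFamily 𝓕.Γ N θ 𝓕.F) :
    ∃ M : ℝ, 0 ≤ M ∧ ∀ (s : Finset 𝓕.Γ), ∀ f ∈ 𝓕.finSpan s, (∀ x, ‖f x‖ ≤ 1) →
      ∃ c : 𝓕.Γ → ℂ, (∀ γ, ‖c γ‖ ≤ M) ∧ ∀ x, HasSum (fun γ => c γ * 𝓕.F γ x) (f x) := by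
  obtain ⟨κ, hκ0, hκ⟩ := exists_norm_cubeProj_le d
  have hblock : ∀ (k : Fin d → ℤ) (γ : 𝓕.Γ),
      ‖cubeProj k (𝓕.toL2 γ)‖ ≤ κ * θ (k - cubeIndex (γ : Rd d)) := by
    intro k γ
    refine hκ k _ _ ?_
    filter_upwards [(𝓕.memLp_F γ).coeFn_toLp] with x hx hxk
    rw [toL2, hx, ← hxk]
    exact h.norm_le γ x
  obtain ⟨M, hM, hcoeff⟩ := exists_bounded_frame_coefficients (blockDecomposition_cubeProj d)
    h.card (fun m => mul_nonneg hκ0 (h.nonneg m)) (h.summable.mul_left κ) hblock hV 𝓕.mem_V 𝓕.frame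
  refine ⟨M * (κ * 1), by positivity, fun s f hf hf1 => ?_⟩
  obtain ⟨b, -, hfb⟩ := 𝓕.exists_sum_of_mem_finSpan hf
  have hfc : Continuous f := by
    rw [hfb]
    exact continuous_finsetSum s fun γ _ => continuous_const.mul (𝓕.continuous_F γ)
  obtain ⟨hb, hbs⟩ := 𝓕.exists_toLp_sum b s
  have hmem : MemLp f 2 volume := by rw [hfb]; exact hb
  have hfV : hmem.toLp f ∈ V := by
    have : hmem.toLp f = hb.toLp _ := by congr
    rw [this, hbs]
    exact V.sum_mem fun γ _ => V.smul_mem _ (𝓕.mem_V γ)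
  -- A function bounded by one has norm at most `κ` on every cube. The new coefficients need not be
  -- the finitely supported `b`, which is not controlled by `f` when the frame is redundant.
  obtain ⟨c, hc, hcs⟩ := hcoeff _ hfV (κ * 1) fun k => hκ k _ _ (by
    filter_upwards [hmem.coeFn_toLp] with x hx _
    rw [hx]
    exact hf1 x)
  refine ⟨c, hc, h.hasSum_of_tendsto_eLpNorm (by positivity) hc hfc two_ne_zero ?_⟩
  have h1 : Tendsto (fun t : Finset 𝓕.Γ => ‖∑ γ ∈ t, c γ • 𝓕.toL2 γ - hmem.toLp f‖ₑ) atTop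
      (𝓝 0) := by
    have h2 : Tendsto (fun t : Finset 𝓕.Γ => ∑ γ ∈ t, c γ • 𝓕.toL2 γ) atTop
      (𝓝 (hmem.toLp f)) := hcs
    have h3 := (h2.sub_const (hmem.toLp f)).enorm
    rwa [sub_self, enorm_zero] at h3
  refine h1.congr fun t => ?_
  obtain ⟨ht, hts⟩ := 𝓕.exists_toLp_sum c t
  rw [← hts, ← MemLp.toLp_sub, Lp.enorm_toLp, ← eLpNorm_neg]
  congr 1
  funext x
  simp

end LocalizedFrame

/-! ### Fekete points -/

/-- A function vanishing under all point evaluations is zero, so evaluations span the dual of `W`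
and a basis can be chosen among them. -/
theorem exists_det_ne_zero {α : Type*} (W : Submodule ℂ (α → ℂ)) {n : ℕ}
    (p : Module.Basis (Fin n) ℂ W) :
    ∃ y : Fin n → α, (Matrix.of fun i j => (p i : α → ℂ) (y j)).det ≠ 0 := by
  have : FiniteDimensional ℂ W := p.finiteDimensional_of_finite
  let ev : α → Module.Dual ℂ W := fun x => (LinearMap.proj x : (α → ℂ) →ₗ[ℂ] ℂ) ∘ₗ W.subtype
  have hev : ∀ x (f : W), ev x f = (f : α → ℂ) x := fun _ _ => rfl
  have hspan : Submodule.span ℂ (Set.range ev) = ⊤ := by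
    rw [← Subspace.dualCoannihilator_dualAnnihilator_eq (W := Submodule.span ℂ (Set.range ev))]
    have : (Submodule.span ℂ (Set.range ev)).dualCoannihilator = ⊥ := by
      rw [eq_bot_iff]
      intro f hf
      rw [Submodule.mem_dualCoannihilator] at hf
      rw [Submodule.mem_bot]
      ext x
      exact hf (ev x) (Submodule.subset_span ⟨x, rfl⟩)
    rw [this, Submodule.dualAnnihilator_bot]
  obtain ⟨b, hb, hbspan, hli⟩ := exists_linearIndependent ℂ (Set.range ev)
  rw [hspan] at hbspan
  let B : Module.Basis b ℂ (Module.Dual ℂ W) := Module.Basis.mk hli (by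
    rw [Subtype.range_coe_subtype, Set.ofPred_mem_eq, hbspan])
  have : Finite b := Module.Finite.finite_basis B
  have : Fintype b := Fintype.ofFinite b
  have hcard : Fintype.card b = n := by
    rw [← Module.finrank_eq_card_basis B, Subspace.dual_finrank_eq,
      Module.finrank_eq_card_basis p, Fintype.card_fin]
  let e : Fin n ≃ b := (Fintype.equivFinOfCardEq hcard).symm
  choose y hy using fun j : Fin n => hb (e j).2
  refine ⟨y, fun hdet => ?_⟩
  obtain ⟨v, hv, hv0⟩ := Matrix.exists_vecMul_eq_zero_iff.2 hdet
  have hzero : ∑ i, v i • p i = 0 := by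
    rw [← Module.forall_dual_apply_eq_zero_iff ℂ]
    intro ℓ
    have hℓ : ℓ ∈ Submodule.span ℂ b := by rw [hbspan]; trivial
    induction hℓ using Submodule.span_induction with
    | mem x hx =>
      have h1 := congrFun hv0 (e.symm ⟨x, hx⟩)
      have h2 : x = ev (y (e.symm ⟨x, hx⟩)) := by rw [hy]; simp
      rw [h2, map_sum]
      simpa [Matrix.vecMul, dotProduct, hev] using h1
    | zero => simp
    | add a b _ _ ha hb => rw [LinearMap.add_apply, ha, hb, add_zero]
    | smul c a _ ha => rw [LinearMap.smul_apply, ha, smul_zero]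
  exact hv (funext fun i => Fintype.linearIndependent_iff.1 p.linearIndependent v hzero i)

/-- Extended by zero, the functions are continuous on the one-point compactification, where a
maximum exists. Since it is nonzero, no maximizing point is at infinity, as this would give a zero
column. -/
theorem exists_isMaxOn_det {d : ℕ} {n : ℕ} {p : Fin n → Rd d → ℂ} (hc : ∀ i, Continuous (p i))
    (h0 : ∀ i, Tendsto (p i) (cocompact (Rd d)) (𝓝 0))
    (hne : ∃ y : Fin n → Rd d, (Matrix.of fun i j => p i (y j)).det ≠ 0) :
    ∃ x : Fin n → Rd d, (Matrix.of fun i j => p i (x j)).det ≠ 0 ∧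
      ∀ y : Fin n → Rd d, ‖(Matrix.of fun i j => p i (y j)).det‖ ≤
        ‖(Matrix.of fun i j => p i (x j)).det‖ := by
  let q : Fin n → OnePoint (Rd d) → ℂ := fun i z => z.elim 0 (p i)
  have hq : ∀ i, Continuous (q i) := by
    intro i
    rw [OnePoint.continuous_iff]
    refine ⟨?_, hc i⟩
    rw [coclosedCompact_eq_cocompact]
    exact h0 i
  have hdet : Continuous fun z : Fin n → OnePoint (Rd d) =>
      ‖(Matrix.of fun i j => q i (z j)).det‖ := by
    refine Continuous.norm (Continuous.matrix_det ?_)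
    exact continuous_matrix fun i j => (hq i).comp (continuous_apply j)
  obtain ⟨z, -, hz⟩ := isCompact_univ.exists_isMaxOn Set.univ_nonempty hdet.continuousOn
  have hz' : ∀ y : Fin n → Rd d, ‖(Matrix.of fun i j => p i (y j)).det‖ ≤
      ‖(Matrix.of fun i j => q i (z j)).det‖ := fun y =>
    hz (Set.mem_univ fun j => (y j : OnePoint (Rd d)))
  obtain ⟨y, hy⟩ := hne
  have hpos : (Matrix.of fun i j => q i (z j)).det ≠ 0 := by
    rw [← norm_pos_iff]
    exact (norm_pos_iff.2 hy).trans_le (hz' y)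
  have hfin : ∀ j, ∃ x : Rd d, (x : OnePoint (Rd d)) = z j := by
    intro j
    rw [← OnePoint.ne_infty_iff_exists]
    intro hj
    exact hpos (Matrix.det_eq_zero_of_column_eq_zero j fun i => by simp [hj, q])
  choose x hx using hfin
  have hxz : (Matrix.of fun i j => p i (x j)) = Matrix.of fun i j => q i (z j) := by
    ext i j
    simp [← hx, q]
  exact ⟨x, by rwa [hxz], fun y => by rw [hxz]; exact hz' y⟩

/-- Finite-dimensional spaces of continuous functions that vanish at infinity have Fekete points;
the associated Lagrange functions are bounded by one. -/
theorem exists_isFeketeSet {d : ℕ} (W : Submodule ℂ (Rd d → ℂ)) [FiniteDimensional ℂ W]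
    (hc : ∀ f ∈ W, Continuous f) (h0 : ∀ f ∈ W, Tendsto f (cocompact (Rd d)) (𝓝 0)) :
    ∃ X : Finset (Rd d), IsFeketeSet W X ∧
      (∀ μ ∈ X, ∃ l ∈ W, (∀ z, ‖l z‖ ≤ 1) ∧ l μ = 1 ∧ ∀ ν ∈ X, ν ≠ μ → l ν = 0) ∧
      ∀ f ∈ W, ∀ z, ‖f z‖ ≤ ∑ μ ∈ X, ‖f μ‖ := by
  classical
  set n := Module.finrank ℂ W
  let p : Module.Basis (Fin n) ℂ W := Module.finBasis ℂ W
  obtain ⟨x, hx, hmax⟩ := exists_isMaxOn_det (fun i => hc _ (p i).2) (fun i => h0 _ (p i).2)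
    (exists_det_ne_zero W p)
  set A : Matrix (Fin n) (Fin n) ℂ := Matrix.of fun i j => (p i : Rd d → ℂ) (x j) with hA
  have hunit : IsUnit A.det := isUnit_iff_ne_zero.2 hx
  let v : Rd d → Fin n → ℂ := fun z i => (p i : Rd d → ℂ) z
  let l : Fin n → Rd d → ℂ := fun j z => (A⁻¹.mulVec (v z)) j
  have hlx : ∀ j k, l j (x k) = if j = k then 1 else 0 := by
    intro j k
    have h1 : l j (x k) = (A⁻¹ * A) j k := rfl
    rw [h1, Matrix.nonsing_inv_mul A hunit, Matrix.one_apply]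
  have hlW : ∀ j, l j ∈ W := by
    intro j
    have : l j = ∑ i, A⁻¹ j i • (p i : Rd d → ℂ) := by
      funext z
      simp [l, v, Matrix.mulVec, dotProduct]
    rw [this]
    exact W.sum_mem fun i _ => W.smul_mem _ (p i).2
  have hl1 : ∀ j z, ‖l j z‖ ≤ 1 := by
    intro j z
    -- Cramer's rule: the numerator is the determinant with `x j` replaced by `z`, so it is
    -- dominated by the maximal one.
    have h1 : l j z = A.det⁻¹ * (A.updateCol j (v z)).det := by
      simp only [l]
      rw [Matrix.inv_def, Matrix.smul_mulVec, ← Matrix.cramer_eq_adjugate_mulVec, Pi.smul_apply,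
        Matrix.cramer_apply, Ring.inverse_eq_inv', smul_eq_mul]
    have h2 : A.updateCol j (v z) =
        Matrix.of fun i k => (p i : Rd d → ℂ) (Function.update x j z k) := by
      ext i k
      simp only [Matrix.updateCol_apply, Matrix.of_apply, Function.update_apply, hA, v]
      split_ifs <;> rfl
    have h3 := hmax (Function.update x j z)
    rw [h1, h2, norm_mul, norm_inv]
    rw [inv_mul_le_iff₀ (norm_pos_iff.2 hx), mul_one]
    exact h3
  have hinj : Function.Injective x := by
    intro j k hjk
    by_contra hne
    have h1 := hlx j k
    rw [if_neg hne, ← hjk, hlx, if_pos rfl] at h1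
    exact one_ne_zero h1
  refine ⟨Finset.univ.image x, ⟨n, p, x, by simp, hmax⟩, ?_, ?_⟩
  · intro μ hμ
    obtain ⟨j, -, rfl⟩ := Finset.mem_image.1 hμ
    refine ⟨l j, hlW j, hl1 j, by rw [hlx, if_pos rfl], fun ν hν hne => ?_⟩
    obtain ⟨k, -, rfl⟩ := Finset.mem_image.1 hν
    rw [hlx, if_neg]
    rintro rfl
    exact hne rfl
  · intro f hf z
    rw [Finset.sum_image fun j _ k _ h => hinj h]
    have hrep : f z = ∑ j, f (x j) * l j z := by
      set a := p.repr ⟨f, hf⟩ with ha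
      have hfa : ∀ y, f y = (Matrix.vecMul a (Matrix.of fun i (_ : Unit) => v y i)) () := by
        intro y
        have h1 : f = ((∑ i, a i • p i : W) : Rd d → ℂ) := by
          rw [ha, p.sum_repr]
        have h2 := congrFun h1 y
        rw [h2]
        simp [Matrix.vecMul, dotProduct, v]
      have h1 : ∑ j, f (x j) * l j z = Matrix.vecMul (fun i => a i) A ⬝ᵥ A⁻¹.mulVec (v z) := by
        simp only [dotProduct]
        refine Finset.sum_congr rfl fun j _ => ?_
        rw [hfa (x j)]
        rfl
      rw [h1, Matrix.dotProduct_mulVec, Matrix.vecMul_vecMul, Matrix.mul_nonsing_inv A hunit,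
        Matrix.vecMul_one, hfa z]
      rfl
    rw [hrep]
    refine (norm_sum_le _ _).trans (Finset.sum_le_sum fun j _ => ?_)
    rw [norm_mul]
    exact mul_le_of_le_one_right (norm_nonneg _) (hl1 j z)

/-! ### Weak limits of separated sets -/

/-- A sequence of uniformly separated sets has a weakly convergent subsequence. -/
theorem exists_setWeakConverges_subseq {d : ℕ} {X : ℕ → Set (Rd d)} {δ : ℝ}
    (hX : ∀ n, (X n).Pairwise fun x y => δ ≤ dist x y) :
    ∃ (φ : ℕ → ℕ) (Λ : Set (Rd d)), StrictMono φ ∧ (Λ.Pairwise fun x y => δ ≤ dist x y) ∧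
      SetWeakConverges (fun j => X (φ j)) Λ := by
  -- An ultrafilter decides for each point whether it is a limit point of the sets, with no diagonal
  -- argument; a genuine subsequence is extracted at the end.
  set U : Ultrafilter ℕ := hyperfilter ℕ with hU
  set Λ : Set (Rd d) := {x | ∀ ε : ℝ, 0 < ε → ∀ᶠ n in (U : Filter ℕ), ∃ y ∈ X n, dist x y < ε}
    with hΛ
  have hsep : Λ.Pairwise fun x y => δ ≤ dist x y := by
    intro x hx y hy hxy
    by_contra! hlt
    have hxy0 := dist_pos.2 hxy
    -- Approximants within `ε` of `x` and `y` cannot coincide, as `2ε ≤ dist x y`, nor be distinct,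
    -- as their distance would be less than `δ`.
    set ε := min (δ - dist x y) (dist x y) / 2 with hε
    have hε0 : 0 < ε := half_pos (lt_min (sub_pos.2 hlt) hxy0)
    obtain ⟨n, ⟨a, ha, hxa⟩, b, hb, hyb⟩ := ((hx ε hε0).and (hy ε hε0)).exists
    have h1 : 2 * ε ≤ δ - dist x y := by
      rw [hε, mul_div_cancel₀ _ two_ne_zero]
      exact min_le_left _ _
    have h2 : 2 * ε ≤ dist x y := by
      rw [hε, mul_div_cancel₀ _ two_ne_zero]
      exact min_le_right _ _
    by_cases hab : a = b
    · subst hab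
      have := dist_triangle_right x y a
      linarith
    · have h3 := hX n ha hb hab
      have h4 := dist_triangle4 a x y b
      rw [dist_comm a x] at h4
      linarith
  have hev : ∀ R ε : ℝ, 0 < ε → ∀ᶠ n in (U : Filter ℕ),
      Λ ∩ Metric.ball 0 R ⊆ Metric.thickening ε (X n) ∧
      X n ∩ Metric.ball 0 R ⊆ Metric.thickening ε Λ := by
    intro R ε hε
    refine Eventually.and ?_ ?_
    · have htb : TotallyBounded (Λ ∩ Metric.ball 0 R) :=
        (isCompact_closedBall (0 : Rd d) R).totallyBounded.subset
          (Set.inter_subset_right.trans Metric.ball_subset_closedBall)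
      obtain ⟨t, htΛ, htf, ht⟩ := Metric.finite_approx_of_totallyBounded htb (ε / 2) (half_pos hε)
      have h1 : ∀ᶠ n in (U : Filter ℕ), ∀ x ∈ t, ∃ y ∈ X n, dist x y < ε / 2 :=
        (htf.eventually_all).2 fun x hx => (htΛ hx).1 _ (half_pos hε)
      filter_upwards [h1] with n hn z hz
      obtain ⟨x, hx, hzx⟩ := Set.mem_iUnion₂.1 (ht hz)
      obtain ⟨y, hy, hxy⟩ := hn x hx
      rw [Metric.mem_thickening_iff]
      refine ⟨y, hy, ?_⟩
      have := dist_triangle z x y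
      rw [Metric.mem_ball] at hzx
      linarith
    · have hK : IsCompact (Metric.closedBall (0 : Rd d) R \ Metric.thickening ε Λ) :=
        (isCompact_closedBall _ _).diff Metric.isOpen_thickening
      have hpt : ∀ x ∈ Metric.closedBall (0 : Rd d) R \ Metric.thickening ε Λ, ∃ r : ℝ, 0 < r ∧
          ∀ᶠ n in (U : Filter ℕ), ∀ y ∈ X n, r ≤ dist x y := by
        intro x hx
        -- For an ultrafilter, failure of an eventual property means that its negation holds
        -- eventually; compactness then makes the avoidance of `X n` uniform.
        have hxΛ : x ∉ Λ := fun h => hx.2 (Metric.self_subset_thickening hε Λ h)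
        rw [hΛ, Set.mem_ofPred_eq] at hxΛ
        push Not at hxΛ
        obtain ⟨r, hr, hr2⟩ := hxΛ
        exact ⟨r, hr, hr2⟩
      choose! r hr0 hr using hpt
      obtain ⟨t, htK, hcov⟩ := hK.elim_nhds_subcover (fun x => Metric.ball x (r x))
        fun x hx => Metric.ball_mem_nhds x (hr0 x hx)
      have h1 : ∀ᶠ n in (U : Filter ℕ), ∀ x ∈ t, ∀ y ∈ X n, r x ≤ dist x y :=
        (t.eventually_all).2 fun x hx => hr x (htK x hx)
      filter_upwards [h1] with n hn z hz
      by_contra hzΛ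
      obtain ⟨x, hx, hzx⟩ := Set.mem_iUnion₂.1
        (hcov ⟨Metric.ball_subset_closedBall hz.2, hzΛ⟩)
      have := hn x hx z hz.1
      rw [Metric.mem_ball, dist_comm] at hzx
      linarith
  obtain ⟨φ, hφ, hφ2⟩ := extraction_forall_of_frequently (P := fun j n =>
      Λ ∩ Metric.ball 0 (j + 1) ⊆ Metric.thickening (1 / (j + 1)) (X n) ∧
      X n ∩ Metric.ball 0 (j + 1) ⊆ Metric.thickening (1 / (j + 1)) Λ) fun j =>
    (hev (j + 1) (1 / (j + 1)) (by positivity)).frequently.filter_mono Nat.hyperfilter_le_atTop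
  refine ⟨φ, Λ, hφ, hsep, fun R ε _ hε => ?_⟩
  obtain ⟨j₁, hj₁⟩ := exists_nat_ge R
  obtain ⟨j₂, hj₂⟩ := exists_nat_one_div_lt hε
  refine ⟨max j₁ j₂, fun j hj => ?_⟩
  have hR : R ≤ j + 1 := by
    have : (j₁ : ℝ) ≤ j := by exact_mod_cast (le_max_left _ _).trans hj
    linarith
  have hε' : (1 : ℝ) / (j + 1) ≤ ε := by
    have h3 : (j₂ : ℝ) ≤ j := by exact_mod_cast (le_max_right _ _).trans hj
    refine le_trans ?_ hj₂.le
    gcongr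
  obtain ⟨h1, h2⟩ := hφ2 j
  exact ⟨fun x hx => Metric.thickening_mono hε' _ (h1 ⟨hx.1, Metric.ball_subset_ball hR hx.2⟩),
    fun x hx => Metric.thickening_mono hε' _ (h2 ⟨hx.1, Metric.ball_subset_ball hR hx.2⟩)⟩

/-- Choosing a nearest point of `X j` to `x` gives one sequence that works for every `ε`. -/
theorem SetWeakConverges.exists_tendsto {d : ℕ} {X : ℕ → Finset (Rd d)} {Λ : Set (Rd d)}
    (h : SetWeakConverges (fun j => (X j : Set (Rd d))) Λ) {x : Rd d} (hx : x ∈ Λ) :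
    ∃ y : ℕ → Rd d, (∀ᶠ j in atTop, y j ∈ X j) ∧ Tendsto y atTop (𝓝 x) := by
  have hmin : ∀ j, ∃ y : Rd d, (X j).Nonempty → y ∈ X j ∧ ∀ z ∈ X j, dist y x ≤ dist z x := by
    intro j
    by_cases hj : (X j).Nonempty
    · obtain ⟨y, hy, hy2⟩ := (X j).exists_min_image (fun z => dist z x) hj
      exact ⟨y, fun _ => ⟨hy, hy2⟩⟩
    · exact ⟨0, fun h => absurd h hj⟩
  choose y hy using hmin
  have hnear : ∀ ε : ℝ, 0 < ε → ∀ᶠ j in atTop, y j ∈ X j ∧ dist (y j) x < ε := by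
    intro ε hε
    obtain ⟨j₀, hj₀⟩ := h (‖x‖ + 1) ε (by positivity) hε
    filter_upwards [eventually_ge_atTop j₀] with j hj
    obtain ⟨z, hz, hxz⟩ := Metric.mem_thickening_iff.1 ((hj₀ j hj).1 ⟨hx, by simp⟩)
    obtain ⟨h1, h2⟩ := hy j ⟨z, hz⟩
    refine ⟨h1, (h2 z hz).trans_lt ?_⟩
    rwa [dist_comm]
  refine ⟨y, (hnear 1 one_pos).mono fun j hj => hj.1, Metric.tendsto_nhds.2 fun ε hε => ?_⟩
  exact (hnear ε hε).mono fun j hj => hj.2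

/-- Sums of a continuous function with a summable envelope over separated sets are upper
semicontinuous under weak convergence. -/
theorem le_tsum_of_setWeakConverges {d : ℕ} {X : ℕ → Finset (Rd d)} {Λ : Set (Rd d)} {δ : ℝ}
    (hδ : 0 < δ) (hX : ∀ j, (X j : Set (Rd d)).Pairwise fun x y => δ ≤ dist x y)
    {N : ℕ} (hN : ∀ j, CubeCardLE (X j : Set (Rd d)) N)
    (hconv : SetWeakConverges (fun j => (X j : Set (Rd d))) Λ) {f : Rd d → ℂ}
    (hfc : Continuous f) {ω : (Fin d → ℤ) → ℝ} (hω0 : ∀ k, 0 ≤ ω k) (hω : Summable ω)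
    (hf : ∀ x, ‖f x‖ ≤ ω (cubeIndex x)) (hsum : Summable fun μ : Λ => ‖f (μ : Rd d)‖)
    {a : ℝ} (ha : ∀ᶠ j in atTop, a ≤ ∑ μ ∈ X j, ‖f μ‖) : a ≤ ∑' μ : Λ, ‖f (μ : Rd d)‖ := by
  classical
  refine le_of_forall_pos_le_add fun ε hε => ?_
  -- Half of `ε` pays for the points outside the cubes in `K`, at most `N` per cube; the other half
  -- pays for moving at most `N * K.card` points inside.
  obtain ⟨K, hK⟩ := ((tendsto_order.1 (tendsto_tsum_compl_atTop_zero ω)).2 (ε / 2 / (N + 1))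
    (by positivity)).exists
  obtain ⟨R, hR⟩ : ∃ R : ℝ, ∀ x : Rd d, cubeIndex x ∈ K → ‖x‖ < R := by
    obtain ⟨R, hR⟩ := (K.finite_toSet.image fun k => ‖latticePoint k‖).bddAbove
    refine ⟨R + (d + 2), fun x hx => ?_⟩
    have h1 : ‖latticePoint (cubeIndex x)‖ ≤ R := hR ⟨_, hx, rfl⟩
    have h2 := norm_sub_latticePoint_le x
    have h3 := norm_le_norm_add_norm_sub (latticePoint (cubeIndex x)) x
    rw [norm_sub_rev] at h3
    linarith
  have huc := hfc.uniformContinuous_of_tendsto_cocompact (tendsto_zero_of_envelope hω hf)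
  obtain ⟨η, hη, hηf⟩ := Metric.uniformContinuous_iff.1 huc (ε / 2 / (N * K.card + 1))
    (by positivity)
  -- Within `δ / 2`, two points of `X j` cannot share a point of `Λ`, so the matching `g` below is
  -- injective.
  set η' := min η (δ / 2)
  have hη' : 0 < η' := lt_min hη (half_pos hδ)
  obtain ⟨j₀, hj₀⟩ := hconv (max R 1) η' (by positivity) hη'
  obtain ⟨j, hja, hj⟩ := (ha.and (eventually_ge_atTop j₀)).exists
  refine hja.trans ?_
  set φ : (Fin d → ℤ) → ℝ := Set.indicator {k | k ∉ K} ω with hφ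
  have hφ0 : ∀ k, 0 ≤ φ k := Set.indicator_nonneg fun k _ => hω0 k
  have hout : ∑ x ∈ X j with ¬ cubeIndex x ∈ K, ‖f x‖ ≤ ε / 2 := by
    have h1 := (hN j).sum_le_tsum hφ0 (hω.indicator _)
      (((X j).filter fun x => ¬ cubeIndex x ∈ K).subtype (· ∈ (X j : Set (Rd d))))
    rw [Finset.sum_subtype_of_mem (p := (· ∈ (X j : Set (Rd d)))) (fun x => φ (cubeIndex x))
      fun x hx => (Finset.mem_filter.1 hx).1] at h1
    have h2 : ∑' k, φ k < ε / 2 / (N + 1) := by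
      rw [hφ, ← tsum_subtype]
      exact hK
    calc ∑ x ∈ X j with ¬ cubeIndex x ∈ K, ‖f x‖
        ≤ ∑ x ∈ X j with ¬ cubeIndex x ∈ K, φ (cubeIndex x) := by
          refine Finset.sum_le_sum fun x hx => ?_
          rw [hφ, Set.indicator_of_mem (by exact (Finset.mem_filter.1 hx).2)]
          exact hf x
      _ ≤ N * (ε / 2 / (N + 1)) := h1.trans (by gcongr)
      _ ≤ (N + 1) * (ε / 2 / (N + 1)) := by gcongr; linarith
      _ = ε / 2 := by field_simp
  have hin : ∑ x ∈ X j with cubeIndex x ∈ K, ‖f x‖ ≤ ∑' μ : Λ, ‖f (μ : Rd d)‖ + ε / 2 := by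
    set B := (X j).filter fun x => cubeIndex x ∈ K with hB
    have hcard : (B.card : ℝ) ≤ N * K.card := by
      have h1 := (hN j).sum_le (φ := fun _ => (1 : ℝ)) (fun _ => zero_le_one)
        (B.subtype (· ∈ (X j : Set (Rd d)))) (t := K) fun x hx =>
          (Finset.mem_filter.1 (Finset.mem_subtype.1 hx)).2
      rw [Finset.sum_subtype_of_mem (p := (· ∈ (X j : Set (Rd d)))) (fun _ => (1 : ℝ)) fun x hx => (Finset.mem_filter.1 hx).1]
        at h1
      simpa using h1
    have hnear : ∀ x ∈ B, ∃ μ : Λ, dist x (μ : Rd d) < η' := by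
      intro x hx
      obtain ⟨hxX, hxK⟩ := Finset.mem_filter.1 hx
      obtain ⟨μ, hμ, hd⟩ := Metric.mem_thickening_iff.1 ((hj₀ j hj).2 ⟨hxX, by
        rw [mem_ball_zero_iff]
        exact (hR x hxK).trans_le (le_max_left _ _)⟩)
      exact ⟨⟨μ, hμ⟩, hd⟩
    by_cases hne : B = ∅
    · rw [hne, Finset.sum_empty]
      have : 0 ≤ ∑' μ : Λ, ‖f (μ : Rd d)‖ := tsum_nonneg fun _ => norm_nonneg _
      linarith
    have : Nonempty Λ := by
      obtain ⟨x, hx⟩ := Finset.nonempty_iff_ne_empty.2 hne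
      exact ⟨(hnear x hx).choose⟩
    choose! g hg using hnear
    have hginj : Set.InjOn g B := by
      intro x hx y hy hxy
      by_contra hxy'
      have h1 := hX j (Finset.mem_filter.1 hx).1 (Finset.mem_filter.1 hy).1 hxy'
      have h2 := dist_triangle_right x y (g x : Rd d)
      have h3 := hg x hx
      have h4 := hg y hy
      rw [← hxy] at h4
      have h5 : η' ≤ δ / 2 := min_le_right _ _
      linarith
    calc ∑ x ∈ B, ‖f x‖ ≤ ∑ x ∈ B, (‖f (g x : Rd d)‖ + ε / 2 / (N * K.card + 1)) := by
          refine Finset.sum_le_sum fun x hx => ?_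
          have h1 := hηf ((hg x hx).trans_le (min_le_left _ _))
          rw [dist_eq_norm] at h1
          have h2 := norm_le_norm_add_norm_sub (f (g x : Rd d)) (f x)
          rw [norm_sub_rev] at h2
          linarith
      _ = ∑ μ ∈ B.image g, ‖f (μ : Rd d)‖ + B.card * (ε / 2 / (N * K.card + 1)) := by
          rw [Finset.sum_add_distrib, Finset.sum_image hginj, Finset.sum_const, nsmul_eq_mul]
      _ ≤ ∑' μ : Λ, ‖f (μ : Rd d)‖ + (N * K.card + 1) * (ε / 2 / (N * K.card + 1)) := by
          refine add_le_add (hsum.sum_le_tsum _ fun _ _ => norm_nonneg _) ?_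
          gcongr
          linarith
      _ = _ := by field_simp
  rw [← Finset.sum_filter_add_sum_filter_not (X j) fun x => cubeIndex x ∈ K]
  linarith

/-! ### Passage of interpolation and sampling to the limit set -/

theorem eLpNorm_top_le_of_norm_le {d : ℕ} {f : Rd d → ℂ} {C : ℝ} (hf : ∀ x, ‖f x‖ ≤ C) :
    eLpNorm f ∞ volume ≤ ENNReal.ofReal C := by
  rw [eLpNorm_exponent_top]
  refine eLpNormEssSup_le_of_ae_enorm_bound (Eventually.of_forall fun x => ?_)
  rw [← ofReal_norm]
  exact ENNReal.ofReal_le_ofReal (hf x)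

theorem enorm_le_eLpNorm_top {d : ℕ} {f : Rd d → ℂ} (hf : Continuous f) (x : Rd d) :
    ‖f x‖ₑ ≤ eLpNorm f ∞ volume := by
  by_contra! hlt
  refine ((isOpen_lt continuous_const hf.enorm).measure_pos volume ⟨x, hlt⟩).ne' ?_
  rw [measure_eq_zero_iff_ae_notMem, eLpNorm_exponent_top]
  filter_upwards [ae_le_eLpNormEssSup (f := f) (μ := volume)] with y hy
  exact not_lt.2 hy

namespace LocalizedFrame

variable {d : ℕ} {V : Submodule ℂ (L2Rd d)}

/-- A drop of the modulus from 1 to 0 exceeds the tolerance `1/2`. The distance `δ` is the same for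
all functions in the unit ball of `V^∞`, hence for all Fekete sets. -/
theorem IsUniform.exists_separation {𝓕 : LocalizedFrame V} (hunif : 𝓕.IsUniform) :
    ∃ δ : ℝ, 0 < δ ∧ ∀ l ∈ 𝓕.space ∞, (∀ x, ‖l x‖ ≤ 1) → ∀ x y, l x = 1 → l y = 0 →
      δ ≤ dist x y := by
  obtain ⟨δ, hδ, h⟩ := hunif (1 / 2) (by norm_num)
  refine ⟨δ, hδ, fun l hl hl1 x y hx hy => ?_⟩
  by_contra! hlt
  have h1 := h x y hlt.le l hl (by simpa using eLpNorm_top_le_of_norm_le hl1)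
  rw [hx, hy] at h1
  norm_num at h1

theorem IsUniform.tendsto_norm_sub {𝓕 : LocalizedFrame V} (hunif : 𝓕.IsUniform)
    {l : ℕ → Rd d → ℂ} (hl : ∀ j, l j ∈ 𝓕.space ∞) (hl1 : ∀ j x, ‖l j x‖ ≤ 1)
    {y : ℕ → Rd d} {x : Rd d} (hy : Tendsto y atTop (𝓝 x)) :
    Tendsto (fun j => ‖l j x‖ - ‖l j (y j)‖) atTop (𝓝 0) := by
  refine Metric.tendsto_nhds.2 fun ε hε => ?_
  obtain ⟨δ, hδ, h⟩ := hunif (ε / 2) (half_pos hε)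
  filter_upwards [Metric.tendsto_nhds.1 hy δ hδ] with j hj
  rw [dist_zero_right, Real.norm_eq_abs]
  rw [dist_comm] at hj
  exact (h x (y j) hj.le (l j) (hl j)
    (by simpa using eLpNorm_top_le_of_norm_le (hl1 j))).trans_lt (half_lt_self hε)

/-- Lagrange functions for a sequence of finite sets have limits that are Lagrange functions for
the weak limit of these sets. -/
theorem exists_limit_lagrange (𝓕 : LocalizedFrame V) (hunif : 𝓕.IsUniform) {N : ℕ}
    {θ : (Fin d → ℤ) → ℝ} (h : IsLocalizedFamily 𝓕.Γ N θ 𝓕.F) {M : ℝ} (hM : 0 ≤ M)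
    {X : ℕ → Finset (Rd d)} {Λ : Set (Rd d)}
    (hlag : ∀ j, ∀ μ ∈ X j, ∃ (l : Rd d → ℂ) (c : 𝓕.Γ → ℂ), (∀ γ, ‖c γ‖ ≤ M) ∧
      (∀ x, HasSum (fun γ => c γ * 𝓕.F γ x) (l x)) ∧ (∀ z, ‖l z‖ ≤ 1) ∧ l μ = 1 ∧
        ∀ ν ∈ X j, ν ≠ μ → l ν = 0)
    (hconv : SetWeakConverges (fun j => (X j : Set (Rd d))) Λ) {μ : Rd d} (hμ : μ ∈ Λ) :
    ∃ (l : Rd d → ℂ) (c : 𝓕.Γ → ℂ), (∀ γ, ‖c γ‖ ≤ M) ∧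
      (∀ x, HasSum (fun γ => c γ * 𝓕.F γ x) (l x)) ∧ (∀ z, ‖l z‖ ≤ 1) ∧ l μ = 1 ∧
        ∀ ν ∈ Λ, ν ≠ μ → l ν = 0 := by
  obtain ⟨y, hyX, hy⟩ := hconv.exists_tendsto hμ
  have hex : ∀ j, ∃ (l : Rd d → ℂ) (c : 𝓕.Γ → ℂ), (∀ γ, ‖c γ‖ ≤ M) ∧
      (∀ x, HasSum (fun γ => c γ * 𝓕.F γ x) (l x)) ∧ (∀ z, ‖l z‖ ≤ 1) ∧
        (y j ∈ X j → l (y j) = 1 ∧ ∀ ν ∈ X j, ν ≠ y j → l ν = 0) := by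
    intro j
    by_cases hj : y j ∈ X j
    · obtain ⟨l, c, h1, h2, h3, h4⟩ := hlag j (y j) hj
      exact ⟨l, c, h1, h2, h3, fun _ => h4⟩
    -- Only the indices with `y j ∉ X j` receive this default, and they are finitely many.
    · exact ⟨0, 0, fun γ => by simpa using hM, fun x => by simp, fun z => by simp,
        fun h => absurd h hj⟩
  choose l c hc hlc hl1 hl using hex
  have hspace : ∀ j, l j ∈ 𝓕.space ∞ := fun j => 𝓕.mem_space_top_of_hasSum h hM (hc j) (hlc j)
  have hclim : ∀ γ, ∃ b : ℂ, ‖b‖ ≤ M ∧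
      Tendsto (fun j => c j γ) (hyperfilter ℕ : Filter ℕ) (𝓝 b) := by
    intro γ
    obtain ⟨b, hb, hb2⟩ := (isCompact_closedBall (0 : ℂ) M).ultrafilter_le_nhds
      ((hyperfilter ℕ).map fun j => c j γ) (by
        rw [le_principal_iff, Ultrafilter.coe_map, mem_map]
        exact univ_mem' fun j => mem_closedBall_zero_iff.2 (hc j γ))
    exact ⟨b, mem_closedBall_zero_iff.1 hb, hb2⟩
  choose b hbM hb using hclim
  set l₀ : Rd d → ℂ := fun x => ∑' γ, b γ * 𝓕.F γ x with hl₀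
  have hl₀sum : ∀ x, HasSum (fun γ => b γ * 𝓕.F γ x) (l₀ x) := h.hasSum_mul hbM
  have hlim : ∀ x, Tendsto (fun j => l j x) (hyperfilter ℕ : Filter ℕ) (𝓝 (l₀ x)) := by
    intro x
    have h1 := h.tendsto_tsum_mul hc hb x
    simpa only [(hlc _ x).tsum_eq] using h1
  -- Equicontinuity concerns moduli only, so what survives from values at the moving points `z j` is
  -- the modulus of the limit.
  have hnorm : ∀ {ν : Rd d} {z : ℕ → Rd d} {a : ℝ}, Tendsto z atTop (𝓝 ν) →
      (∀ᶠ j in atTop, ‖l j (z j)‖ = a) → ‖l₀ ν‖ = a := by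
    intro ν z a hz ha
    have h1 : Tendsto (fun j => ‖l j ν‖) atTop (𝓝 (0 + a)) := by
      refine ((hunif.tendsto_norm_sub hspace hl1 hz).add_const a).congr' ?_
      filter_upwards [ha] with j hj
      rw [hj, sub_add_cancel]
    rw [zero_add] at h1
    exact tendsto_nhds_unique (hlim ν).norm (h1.mono_left Nat.hyperfilter_le_atTop)
  have hl₀1 : ∀ x, ‖l₀ x‖ ≤ 1 := fun x =>
    le_of_tendsto (hlim x).norm (Eventually.of_forall fun j => hl1 j x)
  have hl₀μ : ‖l₀ μ‖ = 1 := by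
    refine hnorm hy ?_
    filter_upwards [hyX] with j hj
    rw [(hl j hj).1, norm_one]
  have hl₀ν : ∀ ν ∈ Λ, ν ≠ μ → l₀ ν = 0 := by
    intro ν hν hne
    obtain ⟨z, hzX, hz⟩ := hconv.exists_tendsto hν
    rw [← norm_eq_zero]
    refine hnorm hz ?_
    have hne' : ∀ᶠ j in atTop, z j ≠ y j :=
      ((hz.dist hy).eventually_ne (dist_ne_zero.2 hne)).mono fun j => dist_ne_zero.1
    filter_upwards [hyX, hzX, hne'] with j h1 h2 h3
    rw [(hl j h1).2 _ h2 h3, norm_zero]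
  -- The value at `μ` is known only up to phase; dividing by it restores the value 1 without
  -- changing the bounds on the function or its coefficients.
  have hinv : ‖(l₀ μ)⁻¹‖ = 1 := by rw [norm_inv, hl₀μ, inv_one]
  refine ⟨fun x => (l₀ μ)⁻¹ * l₀ x, fun γ => (l₀ μ)⁻¹ * b γ, fun γ => ?_, fun x => ?_,
    fun z => ?_, ?_, fun ν hν hne => ?_⟩
  · rw [norm_mul, hinv, one_mul]
    exact hbM γ
  · simpa only [mul_assoc] using (hl₀sum x).mul_left (l₀ μ)⁻¹
  · rw [norm_mul, hinv, one_mul]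
    exact hl₀1 z
  · refine inv_mul_cancel₀ fun h0 => ?_
    rw [h0, norm_zero] at hl₀μ
    exact zero_ne_one hl₀μ
  · dsimp only
    rw [hl₀ν ν hν hne, mul_zero]

/-- The `ℓ¹`-`ℓ^∞` interpolation formula for functions with uniformly bounded coefficients. -/
theorem exists_interpolation (𝓕 : LocalizedFrame V) {N : ℕ} {θ : (Fin d → ℤ) → ℝ}
    (h : IsLocalizedFamily 𝓕.Γ N θ 𝓕.F) {M : ℝ} (hM : 0 ≤ M) {Λ : Set (Rd d)}
    {l : Λ → Rd d → ℂ} {c : Λ → 𝓕.Γ → ℂ} (hc : ∀ μ γ, ‖c μ γ‖ ≤ M)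
    (hl : ∀ μ x, HasSum (fun γ => c μ γ * 𝓕.F γ x) (l μ x)) (hl1 : ∀ μ x, ‖l μ x‖ ≤ 1)
    (hμ : ∀ μ : Λ, l μ (μ : Rd d) = 1) (hν : ∀ μ ν : Λ, μ ≠ ν → l μ (ν : Rd d) = 0)
    {a : Λ → ℂ} (ha : Summable fun μ => ‖a μ‖) :
    ∃ f ∈ 𝓕.space ∞,
      TendstoUniformly (fun (s : Finset Λ) (x : Rd d) => ∑ μ ∈ s, a μ * l μ x) f atTop ∧
      ∀ μ : Λ, f (μ : Rd d) = a μ := by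
  have hle : ∀ μ x, ‖a μ * l μ x‖ ≤ ‖a μ‖ := fun μ x => by
    rw [norm_mul]
    exact mul_le_of_le_one_right (norm_nonneg _) (hl1 μ x)
  have hac : ∀ γ μ, ‖a μ * c μ γ‖ ≤ ‖a μ‖ * M := fun γ μ => by
    rw [norm_mul]
    exact mul_le_mul_of_nonneg_left (hc μ γ) (norm_nonneg _)
  have hcoef : ∀ γ, ‖∑' μ, a μ * c μ γ‖ ≤ (∑' μ, ‖a μ‖) * M := fun γ =>
    tsum_of_norm_bounded (ha.hasSum.mul_right M) (hac γ)
  refine ⟨fun x => ∑' μ, a μ * l μ x,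
    𝓕.mem_space_top_of_hasSum h (mul_nonneg (tsum_nonneg fun _ => norm_nonneg _) hM) hcoef
      fun x => ?_, tendstoUniformly_tsum ha hle, fun μ => ?_⟩
  -- Fubini for the double series: the coefficients of the interpolant are `∑_μ a_μ c^μ_γ`, bounded
  -- by `‖a‖₁ M`.
  · have hdom : Summable fun p : Λ × 𝓕.Γ => a p.1 * c p.1 p.2 * 𝓕.F p.2 x := by
      have h1 := (ha.mul_right M).mul_of_nonneg (h.summable_envelope (cubeIndex x))
        (fun μ => mul_nonneg (norm_nonneg _) hM) fun γ => h.nonneg _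
      refine Summable.of_norm_bounded h1 fun p => ?_
      rw [norm_mul]
      exact mul_le_mul (hac p.2 p.1) (h.norm_le p.2 x) (norm_nonneg _)
        (mul_nonneg (norm_nonneg _) hM)
    have h2 : ∀ μ, HasSum (fun γ => a μ * c μ γ * 𝓕.F γ x) (a μ * l μ x) := fun μ => by
      simpa only [mul_assoc] using (hl μ x).mul_left (a μ)
    have h3 : HasSum (fun p : Λ × 𝓕.Γ => a p.1 * c p.1 p.2 * 𝓕.F p.2 x) (∑' μ, a μ * l μ x) := by
      have h4 := hdom.hasSum.prod_fiberwise h2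
      rw [h4.tsum_eq]
      exact hdom.hasSum
    have h5 : HasSum (fun p : 𝓕.Γ × Λ => a p.2 * c p.2 p.1 * 𝓕.F p.1 x) (∑' μ, a μ * l μ x) :=
      (Equiv.prodComm 𝓕.Γ Λ).hasSum_iff.2 h3
    have h6 : ∀ γ, HasSum (fun μ => a μ * c μ γ * 𝓕.F γ x) ((∑' μ, a μ * c μ γ) * 𝓕.F γ x) :=
      fun γ => (Summable.of_norm_bounded (ha.mul_right M) (hac γ)).hasSum.mul_right _
    exact h5.prod_fiberwise h6
  · dsimp only
    rw [tsum_eq_single μ fun ν hne => by rw [hν ν μ hne, mul_zero], hμ, mul_one]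

/-- Partial sums of a function in `V^1` lie in finite spans and share one envelope, summable over
`Λ`. Both sides of the sampling inequality therefore converge. -/
theorem eLpNorm_top_le_of_finSpan (𝓕 : LocalizedFrame V) {N N' : ℕ} {θ : (Fin d → ℤ) → ℝ}
    (h : IsLocalizedFamily 𝓕.Γ N θ 𝓕.F) {Λ : Set (Rd d)} (hΛ : CubeCardLE Λ N')
    (hfin : ∀ (s : Finset 𝓕.Γ), ∀ f ∈ 𝓕.finSpan s, (Summable fun μ : Λ => ‖f (μ : Rd d)‖) →
      ∀ z, ‖f z‖ ≤ ∑' μ : Λ, ‖f (μ : Rd d)‖) {f : Rd d → ℂ} (hf : f ∈ 𝓕.space 1) :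
    Summable (fun μ : Λ => ‖f (μ : Rd d)‖) ∧
      eLpNorm f ∞ volume ≤ ENNReal.ofReal (∑' μ : Λ, ‖f (μ : Rd d)‖) := by
  obtain ⟨c, hc, hfc, -⟩ := 𝓕.exists_coeff_of_mem_space_one h hf
  obtain ⟨ω, hω0, hω, hfω⟩ := h.exists_envelope_of_summable hc
  have hsum := hΛ.summable hω0 hω
  have hfx : ∀ x, Tendsto (fun s : Finset 𝓕.Γ => ∑ γ ∈ s, c γ * 𝓕.F γ x) atTop (𝓝 (f x)) := hfc
  have hfle : ∀ x, ‖f x‖ ≤ ω (cubeIndex x) := fun x =>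
    le_of_tendsto (hfx x).norm (Eventually.of_forall fun s => hfω s x)
  refine ⟨hsum.of_nonneg_of_le (fun _ => norm_nonneg _) fun μ => hfle μ,
    eLpNorm_top_le_of_norm_le fun x => ?_⟩
  have h1 : Tendsto (fun s : Finset 𝓕.Γ => ∑' μ : Λ, ‖∑ γ ∈ s, c γ * 𝓕.F γ (μ : Rd d)‖) atTop
      (𝓝 (∑' μ : Λ, ‖f (μ : Rd d)‖)) :=
    tendsto_tsum_of_dominated_convergence hsum (fun μ => (hfx μ).norm)
      (Eventually.of_forall fun s μ => by rw [norm_norm]; exact hfω s μ)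
  refine le_of_tendsto_of_tendsto' (hfx x).norm h1 fun s => ?_
  exact hfin s _ (𝓕.sum_mem_finSpan s c)
    (hsum.of_nonneg_of_le (fun _ => norm_nonneg _) fun μ => hfω s μ) x

theorem exists_envelope_of_mem_finSpan (𝓕 : LocalizedFrame V) {N : ℕ} {θ : (Fin d → ℤ) → ℝ}
    (h : IsLocalizedFamily 𝓕.Γ N θ 𝓕.F) {s : Finset 𝓕.Γ} {f : Rd d → ℂ} (hf : f ∈ 𝓕.finSpan s) :
    ∃ ω : (Fin d → ℤ) → ℝ, (∀ k, 0 ≤ ω k) ∧ Summable ω ∧ ∀ x, ‖f x‖ ≤ ω (cubeIndex x) := by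
  obtain ⟨c, hc, hfc⟩ := 𝓕.exists_sum_of_mem_finSpan hf
  obtain ⟨ω, hω0, hω, hle⟩ := h.exists_envelope_of_summable (c := c)
    (summable_of_ne_finset_zero (s := s) fun γ hγ => by rw [hc γ hγ, norm_zero])
  refine ⟨ω, hω0, hω, fun x => ?_⟩
  rw [hfc]
  exact hle s x

end LocalizedFrame

/-! ### Assembly of the main theorem -/

theorem mainTheorem6 {d : ℕ} (V : Submodule ℂ (L2Rd d)) (hV : IsClosed (V : Set (L2Rd d)))
    (𝓕 : LocalizedFrame V) (hunif : 𝓕.IsUniform) :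
    ∃ Λ : Set (Rd d), IsSeparatedSet Λ ∧ IsWeakLimitOfFekete (𝓕.space 1) Λ ∧
      (∃ l : Λ → Rd d → ℂ,
        (∀ μ : Λ, l μ ∈ 𝓕.space ∞ ∧ eLpNorm (l μ) ∞ volume = 1) ∧
        (∀ μ : Λ, l μ (μ : Rd d) = 1) ∧
        (∀ μ ν : Λ, μ ≠ ν → l μ (ν : Rd d) = 0) ∧
        (∀ a : Λ → ℂ, Summable (fun μ => ‖a μ‖) →
          ∃ f ∈ 𝓕.space ∞,
            TendstoUniformly (fun (s : Finset Λ) (x : Rd d) => ∑ μ ∈ s, a μ * l μ x) f atTop ∧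
            ∀ μ : Λ, f (μ : Rd d) = a μ)) ∧
      (∀ f ∈ 𝓕.space 1,
        Summable (fun μ : Λ => ‖f (μ : Rd d)‖) ∧
        eLpNorm f ∞ volume ≤ ENNReal.ofReal (∑' μ : Λ, ‖f (μ : Rd d)‖)) := by
  obtain ⟨N, θ, h⟩ := 𝓕.exists_isLocalizedFamily
  obtain ⟨M, hM, hcoeff⟩ := 𝓕.exists_uniform_coeff_bound hV h
  obtain ⟨δ, hδ, hsepl⟩ := hunif.exists_separation
  obtain ⟨N', hN'⟩ := CubeCardLE.of_separated d hδ
  -- Relative separation makes the set of nodes in each ball finite, so the spans exhaust the frame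
  -- and stay nested along any subsequence.
  let s : ℕ → Finset 𝓕.Γ := fun n => (h.card.finite_norm_le n).toFinset
  have hs : Monotone s := by
    intro m n hmn γ hγ
    simp only [s, Set.Finite.mem_toFinset, Set.mem_ofPred_eq] at hγ ⊢
    exact hγ.trans (by exact_mod_cast hmn)
  have hs_ev : ∀ t : Finset 𝓕.Γ, ∀ᶠ n in atTop, t ⊆ s n := by
    intro t
    refine (t.eventually_all (p := fun γ n => γ ∈ s n)).2 fun γ _ => ?_
    obtain ⟨n, hn⟩ := exists_nat_ge ‖(γ : Rd d)‖
    filter_upwards [eventually_ge_atTop n] with m hm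
    simp only [s, Set.Finite.mem_toFinset, Set.mem_ofPred_eq]
    exact hn.trans (by exact_mod_cast hm)
  have hcont : ∀ (t : Finset 𝓕.Γ), ∀ f ∈ 𝓕.finSpan t, Continuous f := fun t f hf =>
    (𝓕.finSpan_subset_space_one t hf).1
  choose X hfek hlag hsamp using fun n => exists_isFeketeSet (𝓕.finSpan (s n)) (hcont (s n))
    fun f hf => by
      obtain ⟨ω, -, hω, hle⟩ := 𝓕.exists_envelope_of_mem_finSpan h hf
      exact tendsto_zero_of_envelope hω hle
  have hlag' : ∀ n, ∀ μ ∈ X n, ∃ (l : Rd d → ℂ) (c : 𝓕.Γ → ℂ), (∀ γ, ‖c γ‖ ≤ M) ∧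
      (∀ x, HasSum (fun γ => c γ * 𝓕.F γ x) (l x)) ∧ (∀ z, ‖l z‖ ≤ 1) ∧ l μ = 1 ∧
        ∀ ν ∈ X n, ν ≠ μ → l ν = 0 := by
    intro n μ hμ
    obtain ⟨l, hl, hl1, hlμ, hlν⟩ := hlag n μ hμ
    obtain ⟨c, hc, hcl⟩ := hcoeff _ l hl hl1
    exact ⟨l, c, hc, hcl, hl1, hlμ, hlν⟩
  have hXsep : ∀ n, (X n : Set (Rd d)).Pairwise fun x y => δ ≤ dist x y := by
    intro n μ hμ ν hν hne
    obtain ⟨l, c, hc, hcl, hl1, hlμ, hlν⟩ := hlag' n μ hμ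
    exact hsepl l (𝓕.mem_space_top_of_hasSum h hM hc hcl) hl1 μ ν hlμ (hlν ν hν hne.symm)
  obtain ⟨φ, Λ, hφ, hΛ, hconv⟩ := exists_setWeakConverges_subseq hXsep
  choose l c hc hlc hl1 hlμ hlν using fun μ : Λ =>
    𝓕.exists_limit_lagrange hunif h hM (fun j => hlag' (φ j)) hconv μ.2
  have hΛN := hN' Λ hΛ
  refine ⟨Λ, ⟨δ, hδ, hΛ⟩, ⟨fun j => 𝓕.finSpan (s (φ j)), fun j => X (φ j),
    fun i j hij => 𝓕.finSpan_mono (hs (hφ.monotone hij)),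
    fun j => 𝓕.finSpan_subset_space_one _, fun f hf ε hε => ?_, fun j => hfek (φ j), hconv⟩,
    ⟨l, fun μ => ?_, hlμ, fun μ ν hne => hlν μ ν ν.2 fun h => hne (Subtype.ext h.symm),
      fun a ha => 𝓕.exists_interpolation h hM hc hlc hl1 hlμ
        (fun μ ν hne => hlν μ ν ν.2 fun h => hne (Subtype.ext h.symm)) ha⟩,
    fun f hf => 𝓕.eLpNorm_top_le_of_finSpan h hΛN (fun t g hg hgs z => ?_) hf⟩
  · obtain ⟨b, -, -, hb⟩ := 𝓕.exists_coeff_of_mem_space_one h hf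
    obtain ⟨t, ht⟩ := ((tendsto_order.1 hb).2 ε hε).exists
    obtain ⟨j, hj⟩ := (hφ.tendsto_atTop.eventually (hs_ev t)).exists
    exact ⟨j, _, 𝓕.finSpan_mono hj (𝓕.sum_mem_finSpan t b), ht⟩
  · have hspace := 𝓕.mem_space_top_of_hasSum h hM (hc μ) (hlc μ)
    refine ⟨hspace, le_antisymm (by simpa using eLpNorm_top_le_of_norm_le (hl1 μ)) ?_⟩
    -- Continuity turns the value 1 at `μ` into a lower bound for the essential supremum.
    have := enorm_le_eLpNorm_top hspace.1 (μ : Rd d)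
    rwa [hlμ, enorm_one] at this
  · obtain ⟨ω, hω0, hω, hle⟩ := 𝓕.exists_envelope_of_mem_finSpan h hg
    -- For large `j` the span containing `g` lies in the `j`-th space, so the Fekete sampling
    -- inequality applies to `g` with constant one.
    refine le_tsum_of_setWeakConverges hδ (fun j => hXsep (φ j)) (fun j => hN' _ (hXsep (φ j)))
      hconv (hcont t g hg) hω0 hω hle hgs ?_
    filter_upwards [hφ.tendsto_atTop.eventually (hs_ev t)] with j hj
    exact hsamp (φ j) g (𝓕.finSpan_mono hj hg) z
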